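/- Let $q\ge 7$ be an odd prime power, $A=\mathbb{F}_q[T]$, $F=\mathbb{F}_q(T)$, and $G_F=\mathrm{Gal}(F^{\mathrm{sep}}/F)$. Let $F\{\tau\}$ be the ring of twisted polynomials over $F$, with $\tau c=c^q\tau$ for $c\in F$. Let $g_1,g_2\in A$ be such that $\gcd(g_1,T^q-T)$ is $T$ or $T^q-T$ (up to units), and $\gcd(g_2,T^q-T)=1$. Let $\varphi:A\to F\{\tau\}$ be the Drinfeld $A$-module of rank $3$ over $F$ defined by $$\varphi_T=T+g_1^{q-1}\tau+g_2^{q-1}\tau^2+T^{q-1}\tau^3 .$$ Let $\mathfrak{l}=(\ell)$ be a nonzero prime ideal of $A$, let $A_{\mathfrak{l}}=\varprojlim_n A/\mathfrak{l}^n$, and let $T_{\mathfrak{l}}(\varphi)=\varprojlim_n \varphi[\mathfrak{l}^n]$ be the $\mathfrak{l}$-adic Tate module of $\varphi$, where $\varphi[\mathfrak{l}^n]=\{x\in F^{\mathrm{sep}}:\varphi_{\ell^n}(x)=0\}$ and the transition maps are $\varphi_\ell$. Then $T_{\mathfrak{l}}(\varphi)$ is free of rank $3$ over $A_{\mathfrak{l}}$,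 and if $$\rho_{\varphi,\mathfrak{l}}:G_F\to \mathrm{Aut}_{A_{\mathfrak{l}}}(T_{\mathfrak{l}}(\varphi))\cong \mathrm{GL}_3(A_{\mathfrak{l}})$$ denotes the action of $G_F$ on $T_{\mathfrak{l}}(\varphi)$, the homomorphism $$\det\rho_{\varphi,\mathfrak{l}}:G_F\to A_{\mathfrak{l}}^{\times}$$ is surjective. -/

import Mathlib

open Polynomial

/-! ### Tate modules of modules over a commutative ring -/

section Tate

variable {R : Type*} [CommRing R]

/-- The `ℓ`-adic Tate module `lim_n M[ℓ ^ n]` of an `R`-module `M`, the transition maps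
`M[ℓ ^ (n + 1)] → M[ℓ ^ n]` being multiplication by `ℓ`. -/
def TateModule (ℓ : R) (M : Type*) [AddCommGroup M] [Module R M] : Submodule R (ℕ → M) where
  carrier := {x | (∀ n, x n ∈ Submodule.torsionBy R M (ℓ ^ n)) ∧ ∀ n, ℓ • x (n + 1) = x n}
  add_mem' {x y} hx hy := ⟨fun n => add_mem (hx.1 n) (hy.1 n), fun n => by
    rw [Pi.add_apply, smul_add, hx.2, hy.2, Pi.add_apply]⟩
  zero_mem' := ⟨fun _ => zero_mem _, fun _ => smul_zero _⟩
  smul_mem' c x hx := ⟨fun n => Submodule.smul_mem _ c (hx.1 n), fun n => by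
    rw [Pi.smul_apply, smul_comm, hx.2, Pi.smul_apply]⟩

namespace TateModule

variable {ℓ : R} {M : Type*} [AddCommGroup M] [Module R M]

theorem smul_eq_smul {n : ℕ} {a b : R} {m : M} (hm : m ∈ Submodule.torsionBy R M (ℓ ^ n))
    (h : Ideal.Quotient.mk (Ideal.span {ℓ} ^ n) a = Ideal.Quotient.mk (Ideal.span {ℓ} ^ n) b) :
    a • m = b • m := by
  rw [Ideal.Quotient.eq, Ideal.span_singleton_pow, Ideal.mem_span_singleton] at h
  obtain ⟨c, hc⟩ := h
  rw [Submodule.mem_torsionBy_iff] at hm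
  rw [← sub_eq_zero, ← sub_smul, hc, mul_comm, mul_smul, hm, smul_zero]

/-- A representative in `R` of the image of `α ∈ lim_n R / ℓ ^ n` in `R / ℓ ^ n`. -/
noncomputable def rep (α : AdicCompletion (Ideal.span {ℓ}) R) (n : ℕ) : R :=
  (Ideal.Quotient.mk_surjective (AdicCompletion.evalₐ (Ideal.span {ℓ}) n α)).choose

theorem mk_rep (α : AdicCompletion (Ideal.span {ℓ}) R) (n : ℕ) :
    Ideal.Quotient.mk (Ideal.span {ℓ} ^ n) (rep α n) = AdicCompletion.evalₐ _ n α :=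
  (Ideal.Quotient.mk_surjective (AdicCompletion.evalₐ (Ideal.span {ℓ}) n α)).choose_spec

theorem mk_rep_succ (α : AdicCompletion (Ideal.span {ℓ}) R) (n : ℕ) :
    Ideal.Quotient.mk (Ideal.span {ℓ} ^ n) (rep α (n + 1)) = AdicCompletion.evalₐ _ n α := by
  obtain ⟨c, rfl⟩ := AdicCompletion.mk_surjective (Ideal.span {ℓ}) R α
  have h := mk_rep (AdicCompletion.mk (Ideal.span {ℓ}) R c) (n + 1)
  rw [AdicCompletion.evalₐ_mk] at h ⊢
  refine Eq.trans ?_ (AdicCompletion.Ideal.mk_eq_mk _ (Nat.le_succ n) c)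
  rw [Ideal.Quotient.eq] at h ⊢
  exact Ideal.pow_le_pow_right (Nat.le_succ n) h

/-- `lim_n R / ℓ ^ n` acts on `lim_n M[ℓ ^ n]` levelwise. -/
noncomputable instance : SMul (AdicCompletion (Ideal.span {ℓ}) R) (TateModule ℓ M) where
  smul α x := ⟨fun n => rep α n • x.1 n, fun n => Submodule.smul_mem _ _ (x.2.1 n), fun n => by
    rw [smul_comm, x.2.2]
    exact smul_eq_smul (x.2.1 n) ((mk_rep_succ α n).trans (mk_rep α n).symm)⟩

theorem smul_apply (α : AdicCompletion (Ideal.span {ℓ}) R) (x : TateModule ℓ M) (n : ℕ) :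
    (α • x).1 n = rep α n • x.1 n := rfl

noncomputable instance : Module (AdicCompletion (Ideal.span {ℓ}) R) (TateModule ℓ M) where
  one_smul x := by
    ext n
    rw [smul_apply]
    exact (smul_eq_smul (b := 1) (x.2.1 n) (by rw [mk_rep, map_one, map_one])).trans (one_smul _ _)
  mul_smul α β x := by
    ext n
    rw [smul_apply, smul_apply, smul_apply, ← mul_smul]
    exact smul_eq_smul (x.2.1 n) (by rw [mk_rep, map_mul, map_mul, mk_rep, mk_rep])
  smul_zero α := by
    ext n
    exact smul_zero _
  smul_add α x y := by
    ext n
    exact smul_add _ _ _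
  add_smul α β x := by
    ext n
    change rep (α + β) n • x.1 n = rep α n • x.1 n + rep β n • x.1 n
    rw [← add_smul]
    exact smul_eq_smul (x.2.1 n) (by rw [mk_rep, map_add, map_add, mk_rep, mk_rep])
  zero_smul x := by
    ext n
    rw [smul_apply]
    exact (smul_eq_smul (b := 0) (x.2.1 n) (by rw [mk_rep, map_zero, map_zero])).trans
      (zero_smul _ _)

/-- The action of the group of `R`-linear automorphisms of `M` on the Tate module. -/
noncomputable def mapAut :
    (M ≃ₗ[R] M) →* (TateModule ℓ M ≃ₗ[AdicCompletion (Ideal.span {ℓ}) R] TateModule ℓ M) where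
  toFun e :=
    { toFun := fun x => ⟨fun n => e (x.1 n),
        fun n => by
          have h := x.2.1 n
          rw [Submodule.mem_torsionBy_iff] at h ⊢
          rw [← map_smul, h, map_zero],
        fun n => by rw [← map_smul, x.2.2]⟩
      invFun := fun x => ⟨fun n => e.symm (x.1 n),
        fun n => by
          have h := x.2.1 n
          rw [Submodule.mem_torsionBy_iff] at h ⊢
          rw [← map_smul, h, map_zero],
        fun n => by rw [← map_smul, x.2.2]⟩
      map_add' := fun x y => by
        ext n
        exact map_add e _ _
      map_smul' := fun α x => by
        ext n
        exact map_smul e _ _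
      left_inv := fun x => by
        ext n
        exact e.symm_apply_apply _
      right_inv := fun x => by
        ext n
        exact e.apply_symm_apply _ }
  map_one' := rfl
  map_mul' _ _ := rfl

end TateModule

end Tate

/-! ### Twisted polynomials -/

section Twisted

/-- The ring `F{τ}` of twisted polynomials over an extension `F` of the field `k` with `q` elements;
the multiplication defined below satisfies `τ * c = c ^ q * τ` for `c ∈ F`. -/
def TwistedPolynomial (k : Type*) [Field k] [Fintype k] (F : Type*) [Field F] [Algebra k F] :
    Type _ := SkewPolynomial F

variable (k : Type*) [Field k] [Fintype k] (F : Type*) [Field F] [Algebra k F]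

/-- `Multiplicative ℕ` acts on an extension `F` of the field `k` with `q` elements through the
powers of the Frobenius `x ↦ x ^ q`. -/
@[reducible]
noncomputable def frobeniusAction : MulSemiringAction (Multiplicative ℕ) F :=
  MulSemiringAction.compHom F
    (powersHom (F →+* F) (FiniteField.frobeniusAlgHom k F : F →+* F))

namespace TwistedPolynomial

noncomputable instance : Ring (TwistedPolynomial k F) :=
  letI := frobeniusAction k F
  inferInstanceAs (Ring (SkewPolynomial F))

variable {F}

/-- Constant twisted polynomials. -/
noncomputable def C : F →+* TwistedPolynomial k F :=
  letI := frobeniusAction k F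
  (SkewPolynomial.CRingHom : F →+* SkewPolynomial F)

variable (F) in
/-- The variable `τ`. -/
noncomputable def tau : TwistedPolynomial k F := (SkewPolynomial.X : SkewPolynomial F)

variable {k} in
/-- The coefficient of `τ ^ n`. -/
noncomputable def coeff (P : TwistedPolynomial k F) (n : ℕ) : F := SkewPolynomial.coeff P n

theorem frobeniusAction_smul (n : Multiplicative ℕ) (x : F) :
    letI := frobeniusAction k F
    n • x = x ^ Fintype.card k ^ n.toAdd := by
  change ((FiniteField.frobeniusAlgHom k F : F →+* F) ^ n.toAdd) x = _
  induction n.toAdd with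
  | zero => simp
  | succ n ih => rw [pow_succ', RingHom.mul_def, RingHom.comp_apply, ih]; simp [pow_succ, pow_mul]

theorem tau_mul_C (c : F) : tau k F * C k c = C k (c ^ Fintype.card k) * tau k F := by
  let _ := frobeniusAction k F
  have h : (SkewPolynomial.X : SkewPolynomial F) * SkewPolynomial.C c =
      SkewPolynomial.C (c ^ Fintype.card k) * SkewPolynomial.X := by
    rw [SkewPolynomial.X, SkewPolynomial.monomial_mul_C, SkewPolynomial.C_mul_monomial,
      SkewPolynomial.φ_iterate_apply, frobeniusAction_smul]
    simp
  exact h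

theorem C_mul_tau_pow (c : F) (n : ℕ) :
    C k c * tau k F ^ n = (SkewPolynomial.monomial n c : SkewPolynomial F) := by
  let _ := frobeniusAction k F
  exact SkewPolynomial.C_mul_X_pow_eq_monomial (a := c) (n := n)

theorem coeff_C_mul_tau_pow (c : F) (n m : ℕ) :
    (C k c * tau k F ^ n).coeff m = if n = m then c else 0 := by
  rw [C_mul_tau_pow]
  exact SkewPolynomial.coeff_monomial

variable {k} in
theorem coeff_add (P Q : TwistedPolynomial k F) (n : ℕ) :
    (P + Q).coeff n = P.coeff n + Q.coeff n := by
  exact congrFun (congrArg DFunLike.coe (SkewMonoidAlgebra.coeff_add (k := F) P Q)) (Multiplicative.ofAdd n)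

variable {k} in
@[elab_as_elim]
theorem induction_on {motive : TwistedPolynomial k F → Prop} (P : TwistedPolynomial k F)
    (zero : motive 0) (monomial : ∀ c n, motive (C k c * tau k F ^ n))
    (add : ∀ P Q, motive P → motive Q → motive (P + Q)) : motive P :=
  SkewPolynomial.induction (R := F) (motive := motive) P zero fun n c _ _ _ hQ =>
    add _ _ ((C_mul_tau_pow k c n) ▸ monomial c n) hQ

theorem C_algebraMap_comm (c : k) (P : TwistedPolynomial k F) :
    C k (algebraMap k F c) * P = P * C k (algebraMap k F c) := by
  have ht : Commute (C k (algebraMap k F c)) (tau k F) := by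
    rw [Commute, SemiconjBy, tau_mul_C, ← map_pow, FiniteField.pow_card]
  induction P using induction_on with
  | zero => rw [mul_zero, zero_mul]
  | monomial d n =>
    refine (Commute.mul_right ?_ (ht.pow_right n)).eq
    rw [Commute, SemiconjBy, ← map_mul, mul_comm, map_mul]
  | add P Q hP hQ => rw [mul_add, hP, hQ, add_mul]

noncomputable instance : Algebra k (TwistedPolynomial k F) :=
  RingHom.toAlgebra' ((C k).comp (algebraMap k F)) (C_algebraMap_comm k)

/-- The operator `Σ c_n τ ^ n ↦ (z ↦ Σ c_n z ^ (q ^ n))` on an extension `L` of `F`. -/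
noncomputable def evalHom (L : Type*) [Field L] [Algebra k L] [Algebra F L] :
    TwistedPolynomial k F →+* Module.End k L :=
  letI := frobeniusAction k F
  SkewMonoidAlgebra.liftNCRingHom
    ((Algebra.lmul k L : L →+* Module.End k L).comp (algebraMap F L))
    (powersHom (Module.End k L) (FiniteField.frobeniusAlgHom k L).toLinearMap)
    (by
      intro c n
      have h (z : L) : powersHom (Module.End k L) (FiniteField.frobeniusAlgHom k L).toLinearMap n z
          = z ^ Fintype.card k ^ n.toAdd := by
        rw [powersHom_apply]
        induction n.toAdd with
        | zero => simp
        | succ n ih => rw [pow_succ', Module.End.mul_apply, ih]; simp [pow_succ, pow_mul]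
      ext z
      rw [Module.End.mul_apply, Module.End.mul_apply, h, h, frobeniusAction_smul]
      simp [mul_pow])

theorem evalHom_monomial (L : Type*) [Field L] [Algebra k L] [Algebra F L] (c : F) (n : ℕ) :
    evalHom k L (SkewPolynomial.monomial n c : SkewPolynomial F) =
      Algebra.lmul k L (algebraMap F L c) * (FiniteField.frobeniusAlgHom k L).toLinearMap ^ n :=
  SkewMonoidAlgebra.liftNC_single
    (((Algebra.lmul k L : L →+* Module.End k L).comp (algebraMap F L) : F →+* _) : F →+ _)
    (powersHom (Module.End k L) (FiniteField.frobeniusAlgHom k L).toLinearMap)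
    (Multiplicative.ofAdd n) c

theorem evalHom_apply (L : Type*) [Field L] [Algebra k L] [Algebra F L] (c : F) (n : ℕ) (z : L) :
    evalHom k L (C k c * tau k F ^ n) z = algebraMap F L c * z ^ Fintype.card k ^ n := by
  have h : ((FiniteField.frobeniusAlgHom k L).toLinearMap ^ n : Module.End k L) z
      = z ^ Fintype.card k ^ n := by
    induction n with
    | zero => simp
    | succ n ih => rw [pow_succ', Module.End.mul_apply, ih]; simp [pow_succ, pow_mul]
  rw [C_mul_tau_pow, evalHom_monomial, Module.End.mul_apply, h]
  rfl

theorem algEquiv_evalHom (L : Type*) [Field L] [Algebra k L] [Algebra F L] (σ : L ≃ₐ[F] L)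
    (P : TwistedPolynomial k F) (z : L) : σ (evalHom k L P z) = evalHom k L P (σ z) := by
  induction P using induction_on with
  | zero => rw [map_zero, LinearMap.zero_apply, LinearMap.zero_apply, map_zero]
  | monomial c n => rw [evalHom_apply, evalHom_apply, map_mul, map_pow, AlgEquiv.commutes]
  | add P Q hP hQ => rw [map_add, LinearMap.add_apply, LinearMap.add_apply, map_add, hP, hQ]

end TwistedPolynomial

end Twisted

/-! ### Drinfeld modules -/

section Drinfeld

/-- A Drinfeld `k[T]`-module over a `k[T]`-field `F`: a homomorphism `φ : k[T] → F{τ}` of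
`k`-algebras, such that the constant coefficient of `φ_a` is the image of `a` in `F` and such that
not all of the `φ_a` are constant. -/
structure DrinfeldModule (k : Type*) [Field k] [Fintype k] (F : Type*) [Field F] [Algebra k F]
    [Algebra k[X] F] where
  toAlgHom : k[X] →ₐ[k] TwistedPolynomial k F
  coeff_zero : ∀ a, (toAlgHom a).coeff 0 = algebraMap k[X] F a
  nonconstant : ∃ a, toAlgHom a ∉ Set.range (TwistedPolynomial.C k)

namespace DrinfeldModule

variable {k : Type*} [Field k] [Fintype k] {F : Type*} [Field F] [Algebra k F] [Algebra k[X] F]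

/-- The extension `L` of `F`, with `a ∈ k[T]` acting as the operator `φ_a`. -/
def Points (_φ : DrinfeldModule k F) (L : Type*) : Type _ := L

variable (φ : DrinfeldModule k F) (L : Type*) [Field L] [Algebra k L] [Algebra F L]

noncomputable instance : AddCommGroup (φ.Points L) := inferInstanceAs (AddCommGroup L)

noncomputable instance : Module k[X] (φ.Points L) :=
  letI : Module (Module.End k L) (φ.Points L) := inferInstanceAs (Module (Module.End k L) L)
  Module.compHom (φ.Points L)
    ((TwistedPolynomial.evalHom k L).comp (φ.toAlgHom : k[X] →+* TwistedPolynomial k F))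

theorem smul_def (a : k[X]) (x : φ.Points L) :
    a • x = TwistedPolynomial.evalHom k L (φ.toAlgHom a) (x : L) := rfl

/-- The `F`-automorphisms of `L` act by `k[T]`-linear automorphisms on `L`. -/
noncomputable def galoisAction : (L ≃ₐ[F] L) →* (φ.Points L ≃ₗ[k[X]] φ.Points L) where
  toFun σ :=
    { toFun := fun x => σ x
      invFun := fun x => σ.symm x
      map_add' := fun x y => map_add σ x y
      map_smul' := fun a x => by
        exact TwistedPolynomial.algEquiv_evalHom k L σ (φ.toAlgHom a) x
      left_inv := fun x => σ.symm_apply_apply x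
      right_inv := fun x => σ.apply_symm_apply x }
  map_one' := rfl
  map_mul' _ _ := rfl

/-- The `ℓ`-adic Tate module of `φ`, over the separable closure of `F`. -/
noncomputable abbrev Tate (ℓ : k[X]) := TateModule ℓ (φ.Points (SeparableClosure F))

/-- The `ℓ`-adic Galois representation of `φ`, as an action of the absolute Galois group of `F` on
the `ℓ`-adic Tate module, linear over the completion `lim_n k[T] / ℓ ^ n`. -/
noncomputable def adicRep (ℓ : k[X]) :
    (SeparableClosure F ≃ₐ[F] SeparableClosure F) →*
      (φ.Tate ℓ ≃ₗ[AdicCompletion (Ideal.span {ℓ}) k[X]] φ.Tate ℓ) :=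
  TateModule.mapAut.comp (φ.galoisAction (SeparableClosure F))

end DrinfeldModule

end Drinfeld

/-! The proof compares `φ`, through the Weil pairing, with the Carlitz module `θ + τ`, where `θ`
is the image of `T`. Put `D = θ + g₁ ^ (q - 1) τ + g₂ ^ (q - 1) τ ^ 2 + θ ^ (q - 1) τ ^ 3`, an
operator on the separable closure `L`.

For the freeness, the polynomial of `a(D)` has degree `q ^ (3 deg a)` and constant derivative
`a(θ)`. Hence `L` is `ℓ`-divisible and `φ[ℓ]` has dimension `3` over `k[T] / ℓ`. A basis of
`φ[ℓ]`, divided by `ℓ` again and again, gives a basis of the Tate module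
(`TateModule.nonempty_basis`).

For the determinant, fix `B = k[T] / ℓ ^ n` and a linear form `λ` on `B` that vanishes on no
nonzero ideal. It identifies `L ⊗ B` with `Hom_k(B, L)`, so that the orbit map `b ↦ b x` of a
torsion point `x` becomes an element `F_x` of `L ⊗ B`, and the action of `T` on the orbit becomes
the equation `(t - θ) F = g₁ ^ (q - 1) F' + g₂ ^ (q - 1) F'' + θ ^ (q - 1) F'''`, primes denoting
Frobenius on the coefficients. The Casorati determinant `W` of the `F_x`, for a basis of
`φ[ℓ ^ n]`, satisfies `θ ^ (q - 1) W' = (t - θ) W`, so `U = θ W` satisfies the equation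
`U' = (t - θ) U` of the Carlitz module; it is here that the leading coefficient being
`θ ^ (q - 1)` matters. By the non-vanishing of Moore determinants `W` is a unit, so `U` comes from
a generator `u` of the `ℓ ^ n`-torsion of the Carlitz module, and an automorphism `σ` multiplies
`U`, and thus `u`, by the determinant of `σ` on `φ[ℓ ^ n]` (`exists_carlitz_torsion`).

The generators of the Carlitz torsion are the roots of a polynomial over `k[T]` which is
Eisenstein at `ℓ`, so the Galois group permutes them transitively (`exists_algEquiv_carlitz`).
Hence the determinant is surjective at each finite level, and the Galois group being compact it is
surjective in the limit. -/

open scoped TensorProduct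

/-! ### Bases of Tate modules -/

namespace TateModule

variable {R : Type*} [CommRing R] {ℓ : R} {M : Type*} [AddCommGroup M] [Module R M]

/-- Every `ℓ`-torsion element of an `ℓ`-divisible module lifts to the Tate module. -/
theorem exists_apply_one_eq (hdiv : ∀ m : M, ∃ m', ℓ • m' = m) {x : M} (hx : ℓ • x = 0) :
    ∃ e : TateModule ℓ M, e.1 1 = x := by
  choose f hf using hdiv
  have key : ∀ n, ℓ • (Nat.rec 0 (fun n _ => f^[n] x) (n + 1) : M) =
      (Nat.rec 0 (fun n _ => f^[n] x) n : M) := by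
    rintro (_ | n)
    · exact hx
    · change ℓ • f^[n + 1] x = f^[n] x
      rw [Function.iterate_succ_apply', hf]
  refine ⟨⟨fun n => Nat.rec 0 (fun n _ => f^[n] x) n, fun n => ?_, key⟩, rfl⟩
  rw [Submodule.mem_torsionBy_iff]
  induction n with
  | zero => exact smul_zero _
  | succ n ih => rw [pow_succ, mul_smul, key, ih]

theorem pow_smul_apply (x : TateModule ℓ M) (n m : ℕ) : ℓ ^ m • x.1 (n + m) = x.1 n := by
  induction m with
  | zero => simp
  | succ m ih => rw [pow_succ, mul_smul, ← add_assoc, x.2.2, ih]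

variable {ι : Type*} [Fintype ι] {e : ι → TateModule ℓ M}

theorem sum_smul_apply (α : ι → AdicCompletion (Ideal.span {ℓ}) R) (n : ℕ) :
    (∑ i, α i • e i).1 n = ∑ i, rep (α i) n • (e i).1 n := by
  rw [AddSubmonoidClass.coe_finsetSum, Finset.sum_apply]
  rfl

/-- If the components `e i` in `M[ℓ]` are independent over `R / ℓ`, then those in `M[ℓ ^ n]` are
independent over `R / ℓ ^ n`. -/
theorem pow_dvd_of_sum_eq_zero
    (hind : ∀ c : ι → R, ∑ i, c i • (e i).1 1 = 0 → ∀ i, ℓ ∣ c i) (n : ℕ) (c : ι → R)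
    (hc : ∑ i, c i • (e i).1 n = 0) (i : ι) : ℓ ^ n ∣ c i := by
  induction n generalizing c with
  | zero => simp
  | succ n ih =>
    have h1 : ∀ i, ℓ ∣ c i := by
      refine hind c ?_
      have := congrArg (fun m => ℓ ^ n • m) hc
      simp only [Finset.smul_sum, smul_zero] at this
      rw [← this]
      refine Finset.sum_congr rfl fun i _ => ?_
      rw [smul_comm, add_comm n 1, pow_smul_apply]
    choose d hd using h1
    have h2 : ∑ i, d i • (e i).1 n = 0 := by
      rw [← hc]
      refine Finset.sum_congr rfl fun i _ => ?_
      rw [hd, mul_comm, mul_smul, (e i).2.2]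
    rw [hd, pow_succ']
    exact mul_dvd_mul_left ℓ (ih d h2)

/-- If the components `e i` in `M[ℓ]` generate it, then those in `M[ℓ ^ n]` generate it. -/
theorem exists_sum_eq (hgen : ∀ m : M, ℓ • m = 0 → ∃ c : ι → R, ∑ i, c i • (e i).1 1 = m) (n : ℕ)
    (m : M) (hm : ℓ ^ n • m = 0) : ∃ c : ι → R, ∑ i, c i • (e i).1 n = m := by
  induction n generalizing m with
  | zero =>
    refine ⟨0, ?_⟩
    rw [pow_zero, one_smul] at hm
    simp [hm]
  | succ n ih =>
    obtain ⟨b, hb⟩ := ih (ℓ • m) (by rw [← mul_smul, ← pow_succ, hm])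
    obtain ⟨c, hc⟩ := hgen (m - ∑ i, b i • (e i).1 (n + 1)) (by
      rw [smul_sub, ← hb, Finset.smul_sum, sub_eq_zero]
      refine Finset.sum_congr rfl fun i _ => ?_
      rw [smul_comm, (e i).2.2])
    refine ⟨fun i => b i + ℓ ^ n * c i, ?_⟩
    rw [eq_sub_iff_add_eq] at hc
    rw [← hc, ← Finset.sum_add_distrib]
    refine Finset.sum_congr rfl fun i _ => ?_
    rw [add_smul, add_comm, mul_comm, mul_smul]
    congr 2
    rw [add_comm n 1, pow_smul_apply]

/-- Elements of the Tate module whose components in `M[ℓ]` form a basis over `R / ℓ` are a basis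
over the completion. -/
theorem nonempty_basis
    (hind : ∀ c : ι → R, ∑ i, c i • (e i).1 1 = 0 → ∀ i, ℓ ∣ c i)
    (hgen : ∀ m : M, ℓ • m = 0 → ∃ c : ι → R, ∑ i, c i • (e i).1 1 = m) :
    ∃ b : Module.Basis ι (AdicCompletion (Ideal.span {ℓ}) R) (TateModule ℓ M), ⇑b = e := by
  have hli : LinearIndependent (AdicCompletion (Ideal.span {ℓ}) R) e := by
    rw [Fintype.linearIndependent_iff]
    intro α hα i
    refine AdicCompletion.ext_evalₐ fun n => ?_
    have h := congrArg (fun x => x.1 n) hα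
    simp only [sum_smul_apply] at h
    rw [map_zero, ← mk_rep, Ideal.Quotient.eq_zero_iff_mem, Ideal.span_singleton_pow,
      Ideal.mem_span_singleton]
    exact pow_dvd_of_sum_eq_zero hind n _ h i
  refine ⟨Module.Basis.mk hli ?_, Module.Basis.coe_mk _ _⟩
  rintro x -
  have hx n : ℓ ^ n • x.1 n = 0 := (Submodule.mem_torsionBy_iff _ _).1 (x.2.1 n)
  choose c hc using fun n => exists_sum_eq hgen n (x.1 n) (hx n)
  -- By independence the coefficients at level `n` are unique modulo `ℓ ^ n`, hence compatible.
  have hcauchy i n : c n i ≡ c (n + 1) i [SMOD (Ideal.span {ℓ} ^ n • ⊤ : Ideal R)] := by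
    rw [SModEq.comm, SModEq.sub_mem, smul_eq_mul, Ideal.mul_top, Ideal.span_singleton_pow,
      Ideal.mem_span_singleton]
    refine pow_dvd_of_sum_eq_zero hind n (fun i => c (n + 1) i - c n i) ?_ i
    simp only [sub_smul, Finset.sum_sub_distrib, hc]
    rw [sub_eq_zero, ← x.2.2, ← hc, Finset.smul_sum]
    refine Finset.sum_congr rfl fun i _ => ?_
    rw [smul_comm, (e i).2.2]
  let α i : AdicCompletion (Ideal.span {ℓ}) R :=
    AdicCompletion.mk _ _ (AdicCompletion.AdicCauchySequence.mk _ _ (fun n => c n i) (hcauchy i))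
  have hα : ∑ i, α i • e i = x := by
    ext n
    rw [sum_smul_apply, ← hc]
    refine Finset.sum_congr rfl fun i _ => smul_eq_smul ((e i).2.1 n) ?_
    rw [mk_rep, AdicCompletion.evalₐ_mk]
    rfl
  rw [← hα]
  exact Submodule.sum_mem _ fun i _ => Submodule.smul_mem _ _ (Submodule.subset_span ⟨i, rfl⟩)

end TateModule

/-! ### Operators given by twisted polynomials, and their polynomials -/

section TwistedOperators

variable {k : Type*} [Field k]

/-- A linear map which intertwines `D` and `D'` intertwines `a(D)` and `a(D')`. -/
theorem map_aeval_end_apply {V W : Type*} [AddCommGroup V] [Module k V] [AddCommGroup W]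
    [Module k W] (f : V →ₗ[k] W) {D : Module.End k V} {D' : Module.End k W}
    (h : ∀ v, f (D v) = D' (f v)) (a : k[X]) (v : V) : f (aeval D a v) = aeval D' a (f v) := by
  induction a using Polynomial.induction_on' generalizing v with
  | add p q hp hq => simp only [map_add, LinearMap.add_apply, hp, hq]
  | monomial n s =>
    rw [aeval_monomial, aeval_monomial, Module.End.mul_apply, Module.End.mul_apply,
      Module.algebraMap_end_apply, Module.algebraMap_end_apply, map_smul]
    congr 1
    induction n generalizing v with
    | zero => simp
    | succ n ih => rw [pow_succ, pow_succ, Module.End.mul_apply, Module.End.mul_apply, ih, h]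

theorem aeval_end_apply_mem {V : Type*} [AddCommGroup V] [Module k V] (N : Submodule k V)
    {D : Module.End k V} (h : ∀ v ∈ N, D v ∈ N) (a : k[X]) {v : V} (hv : v ∈ N) :
    aeval D a v ∈ N := by
  induction a using Polynomial.induction_on' with
  | add p q hp hq =>
    rw [map_add, LinearMap.add_apply]
    exact add_mem hp hq
  | monomial n s =>
    rw [aeval_monomial, Module.End.mul_apply, Module.algebraMap_end_apply]
    refine N.smul_mem _ ?_
    induction n with
    | zero => simpa
    | succ n ih =>
      rw [pow_succ', Module.End.mul_apply]
      exact h _ ih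

theorem aeval_mul_leadingCoeff_inv_pow_eq_zero_iff {L : Type*} [Field L] [Algebra k L]
    {D : Module.End k L} {ℓ : k[X]} (hℓ : ℓ ≠ 0) (n : ℕ) (u : L) :
    aeval D ((ℓ * C ℓ.leadingCoeff⁻¹) ^ n) u = 0 ↔ aeval D (ℓ ^ n) u = 0 := by
  have h : (ℓ * C ℓ.leadingCoeff⁻¹) ^ n = C (ℓ.leadingCoeff⁻¹ ^ n) * ℓ ^ n := by
    rw [mul_pow, mul_comm, ← C_pow]
  rw [h, map_mul, Module.End.mul_apply, aeval_C, Module.algebraMap_end_apply, smul_eq_zero,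
    or_iff_right (pow_ne_zero _ (inv_ne_zero (leadingCoeff_ne_zero.2 hℓ)))]

variable [Fintype k] {S : Type*} [CommRing S] [Algebra k S]

variable (k) in
/-- The `k`-linear operator `x ↦ Σ_{j ≤ r} c_j x ^ (q ^ j)` on a commutative algebra over the field
`k` with `q` elements: the action of the twisted polynomial `Σ_{j ≤ r} c_j τ ^ j`. -/
noncomputable def twistedOp (c : ℕ → S) (r : ℕ) : Module.End k S :=
  ∑ j ∈ Finset.range (r + 1),
    Algebra.lmul k S (c j) * (FiniteField.frobeniusAlgHom k S).toLinearMap ^ j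

theorem frobeniusAlgHom_toLinearMap_pow_apply (j : ℕ) (x : S) :
    ((FiniteField.frobeniusAlgHom k S).toLinearMap ^ j : Module.End k S) x =
      x ^ Fintype.card k ^ j := by
  induction j with
  | zero => simp
  | succ n ih => rw [pow_succ', Module.End.mul_apply, ih]; simp [pow_succ, pow_mul]

theorem twistedOp_apply (c : ℕ → S) (r : ℕ) (x : S) :
    twistedOp k c r x = ∑ j ∈ Finset.range (r + 1), c j * x ^ Fintype.card k ^ j := by
  simp [twistedOp, LinearMap.sum_apply, frobeniusAlgHom_toLinearMap_pow_apply]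

theorem map_aeval_twistedOp {S' : Type*} [CommRing S'] [Algebra k S'] (f : S →ₐ[k] S')
    {c : ℕ → S} {c' : ℕ → S'} (h : ∀ j, f (c j) = c' j) (r : ℕ) (a : k[X]) (x : S) :
    f (aeval (twistedOp k c r) a x) = aeval (twistedOp k c' r) a (f x) := by
  refine map_aeval_end_apply f.toLinearMap (fun v => ?_) a x
  simp [twistedOp_apply, map_sum, h]

variable (k) in
/-- The additive polynomial over `S` which induces the operator `a(c_0 + c_1 τ + ⋯ + c_r τ ^ r)`. -/
noncomputable def twistedPoly (c : ℕ → S) (r : ℕ) (a : k[X]) : S[X] :=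
  aeval (twistedOp k (fun j => C (c j)) r) a X

theorem eval₂_twistedPoly {S' : Type*} [CommRing S'] [Algebra k S'] (f : S →ₐ[k] S')
    {c : ℕ → S} {c' : ℕ → S'} (h : ∀ j, f (c j) = c' j) (r : ℕ) (a : k[X]) (x : S') :
    (twistedPoly k c r a).eval₂ (f : S →+* S') x = aeval (twistedOp k c' r) a x := by
  let g : S[X] →ₐ[k] S' := AlgHom.mk (eval₂RingHom (f : S →+* S') x) (fun s => by
    simp [Polynomial.algebraMap_apply])
  have h1 := map_aeval_twistedOp g (c := fun j => C (c j)) (c' := c')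
    (fun j => by simp [g, h]) r a X
  have h2 : g X = x := by simp [g]
  rw [h2] at h1
  exact h1

theorem eval_twistedPoly (c : ℕ → S) (r : ℕ) (a : k[X]) (x : S) :
    (twistedPoly k c r a).eval x = aeval (twistedOp k c r) a x :=
  eval₂_twistedPoly (AlgHom.id k S) (fun _ => rfl) r a x

theorem twistedPoly_mul (c : ℕ → S) (r : ℕ) (a b : k[X]) :
    twistedPoly k c r (a * b) = (twistedPoly k c r a).comp (twistedPoly k c r b) := by
  have := eval₂_twistedPoly (Algebra.ofId S S[X] |>.restrictScalars k) (c := c)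
    (c' := fun j => C (c j)) (fun j => rfl) r a (twistedPoly k c r b)
  rw [twistedPoly, map_mul, Module.End.mul_apply]
  exact this.symm

theorem twistedPoly_divX (c : ℕ → S) (r : ℕ) (a : k[X]) :
    twistedPoly k c r a = twistedOp k (fun j => C (c j)) r (twistedPoly k c r a.divX) +
      a.coeff 0 • X := by
  have h : twistedPoly k c r (X * a.divX + C (a.coeff 0)) =
      twistedOp k (fun j => C (c j)) r (twistedPoly k c r a.divX) + a.coeff 0 • X := by
    simp only [twistedPoly, map_add, map_mul, LinearMap.add_apply, Module.End.mul_apply, aeval_X,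
      aeval_C, Module.algebraMap_end_apply]
  rwa [mul_comm, divX_mul_X_add] at h

/-- The powers of `τ` do not contribute to the derivative, which is therefore constant. -/
theorem derivative_twistedPoly (c : ℕ → S) (r : ℕ) (a : k[X]) :
    derivative (twistedPoly k c r a) = C (aeval (c 0) a) := by
  have hq : (Fintype.card k : S) = 0 := by
    rw [← map_natCast (algebraMap k S), FiniteField.cast_card_eq_zero, map_zero]
  have h := map_aeval_end_apply (derivative.restrictScalars k : S[X] →ₗ[k] S[X])
    (D := twistedOp k (fun j => C (c j)) r) (D' := Algebra.lmul k S[X] (C (c 0)))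
    (fun P => by
      simp only [LinearMap.restrictScalars_apply, twistedOp_apply, derivative_sum,
        derivative_C_mul, derivative_pow, Nat.cast_pow, hq]
      rw [Finset.sum_range_succ', Finset.sum_eq_zero (fun j _ => by simp), zero_add]
      simp) a X
  rw [LinearMap.restrictScalars_apply, LinearMap.restrictScalars_apply, derivative_X,
    aeval_algHom_apply] at h
  change derivative (twistedPoly k c r a) = aeval (algebraMap S S[X] (c 0)) a * 1 at h
  rw [h, aeval_algebraMap_apply, mul_one]
  rfl

/-- By Horner's scheme `a = T a' + a(0)`, each step of which raises the degree to the `q ^ r`-th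
multiple. -/
theorem natDegree_twistedPoly_and_monic [IsDomain S] {c : ℕ → S} {r : ℕ} (hr : r ≠ 0)
    (hc : c r ≠ 0) {a : k[X]} (ha : a ≠ 0) :
    (twistedPoly k c r a).natDegree = Fintype.card k ^ (r * a.natDegree) ∧
      (c r = 1 → a.Monic → (twistedPoly k c r a).Monic) := by
  have hq : 1 < Fintype.card k := Fintype.one_lt_card
  induction hn : a.natDegree generalizing a with
  | zero =>
    obtain ⟨s, rfl⟩ := natDegree_eq_zero.1 hn
    have hs : s ≠ 0 := fun h => ha (by rw [h, C_0])
    have h : twistedPoly k c r (C s) = C (algebraMap k S s) * X := by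
      rw [twistedPoly, aeval_C, Module.algebraMap_end_apply, Algebra.smul_def]
      rfl
    refine ⟨?_, fun _ hm => ?_⟩
    · rw [h, natDegree_C_mul (by simpa using hs)]
      simp
    · have : s = 1 := by simpa [Monic] using hm
      rw [h, this]
      simp [monic_X]
  | succ n ih =>
    have hb : a.divX ≠ 0 := fun h => by
      rw [divX_eq_zero_iff] at h
      rw [h, natDegree_C] at hn
      omega
    have hbn : a.divX.natDegree = n := by rw [natDegree_divX_eq_natDegree_tsub_one, hn]; rfl
    obtain ⟨h1, h2⟩ := ih hb hbn
    set P := twistedPoly k c r a.divX with hP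
    have hP0 : P ≠ 0 := fun h => by
      rw [h, natDegree_zero] at h1
      exact (pow_pos (by omega) _).ne h1
    have hdeg j : (C (c j) * P ^ Fintype.card k ^ j).natDegree ≤
        Fintype.card k ^ j * Fintype.card k ^ (r * n) := by
      rw [← h1, ← natDegree_pow]
      exact natDegree_C_mul_le _ _
    -- Every term but the top one has degree below that of the top one.
    have hlow : (∑ j ∈ Finset.range r, C (c j) * P ^ Fintype.card k ^ j + a.coeff 0 • X).natDegree
        < Fintype.card k ^ (r * (n + 1)) := by
      refine (natDegree_add_le _ _).trans_lt (max_lt ?_ ?_)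
      · refine (natDegree_sum_le_of_forall_le (n := Fintype.card k ^ (r - 1 + r * n)) _ _
          fun j hj => (hdeg j).trans ?_).trans_lt ?_
        · rw [← pow_add]
          refine Nat.pow_le_pow_right (by omega) ?_
          have := Finset.mem_range.1 hj
          omega
        · refine Nat.pow_lt_pow_right hq ?_
          rw [mul_add]
          omega
      · refine (natDegree_smul_le _ _).trans_lt ?_
        rw [natDegree_X]
        exact Nat.one_lt_pow (Nat.mul_ne_zero hr (by omega)) hq
    have htop : (C (c r) * P ^ Fintype.card k ^ r).natDegree = Fintype.card k ^ (r * (n + 1)) := by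
      rw [natDegree_C_mul hc, natDegree_pow, h1, ← pow_add, mul_add, mul_one, add_comm]
    have heq : twistedPoly k c r a =
        (∑ j ∈ Finset.range r, C (c j) * P ^ Fintype.card k ^ j + a.coeff 0 • X) +
          C (c r) * P ^ Fintype.card k ^ r := by
      rw [twistedPoly_divX, twistedOp_apply, Finset.sum_range_succ]
      ring
    refine ⟨?_, fun hc1 hm => ?_⟩
    · rw [heq, natDegree_add_eq_right_of_natDegree_lt (htop ▸ hlow), htop]
    · rw [heq]
      refine Monic.add_of_right ?_ (degree_lt_degree (htop ▸ hlow))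
      rw [hc1, C_1, one_mul]
      refine Monic.pow (h2 hc1 ?_) _
      rw [Monic, leadingCoeff, hbn, coeff_divX, ← hn]
      exact hm

/-- If `a(c_0) ≠ 0`, then `a(c_0 + ⋯ + c_r τ ^ r)` is a surjective operator on a separably closed
field: its polynomial, translated by a constant, has the nonzero constant derivative `a(c_0)`. -/
theorem aeval_twistedOp_surjective {L : Type*} [Field L] [Algebra k L] [IsSepClosed L] {c : ℕ → L}
    {r : ℕ} (hr : r ≠ 0) (hc : c r ≠ 0) {a : k[X]} (ha : aeval (c 0) a ≠ 0) (y : L) :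
    ∃ x, aeval (twistedOp k c r) a x = y := by
  have ha0 : a ≠ 0 := fun h => ha (by rw [h, map_zero])
  have h0 := (natDegree_twistedPoly_and_monic hr hc ha0).1
  have hsep : (twistedPoly k c r a - C y).Separable := by
    rw [separable_def, derivative_sub, derivative_C, sub_zero, derivative_twistedPoly]
    exact ⟨0, C (aeval (c 0) a)⁻¹, by rw [zero_mul, zero_add, ← C_mul, inv_mul_cancel₀ ha, C_1]⟩
  obtain ⟨x, hx⟩ := IsSepClosed.exists_root (twistedPoly k c r a - C y) (fun h => by
    have := natDegree_eq_of_degree_eq_some h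
    rw [natDegree_sub_C, h0] at this
    exact (pow_pos Fintype.card_pos _).ne' this) hsep
  refine ⟨x, ?_⟩
  rwa [IsRoot, eval_sub, eval_C, eval_twistedPoly, sub_eq_zero] at hx

/-- The kernel of `a(c_0 + ⋯ + c_r τ ^ r)` on a separably closed field has `q ^ (r deg a)`
elements if `a(c_0) ≠ 0`, as its polynomial is separable. -/
theorem card_ker_aeval_twistedOp {L : Type*} [Field L] [Algebra k L] [IsSepClosed L] {c : ℕ → L}
    {r : ℕ} (hr : r ≠ 0) (hc : c r ≠ 0) {a : k[X]} (ha : aeval (c 0) a ≠ 0) :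
    Nat.card {x // aeval (twistedOp k c r) a x = 0} = Fintype.card k ^ (r * a.natDegree) := by
  classical
  have ha0 : a ≠ 0 := fun h => ha (by rw [h, map_zero])
  have h0 := (natDegree_twistedPoly_and_monic hr hc ha0).1
  have hsep : (twistedPoly k c r a).Separable := by
    rw [separable_def, derivative_twistedPoly]
    exact ⟨0, C (aeval (c 0) a)⁻¹, by rw [zero_mul, zero_add, ← C_mul, inv_mul_cancel₀ ha, C_1]⟩
  rw [← h0, ← splits_iff_card_roots.1 (IsSepClosed.splits_of_separable _ hsep),
    ← Multiset.toFinset_card_of_nodup (nodup_roots hsep), ← Nat.card_eq_finsetCard]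
  refine Nat.card_congr (Equiv.subtypeEquivRight fun x => ?_)
  rw [Multiset.mem_toFinset, mem_roots hsep.ne_zero, IsRoot, eval_twistedPoly]

end TwistedOperators

/-! ### The Carlitz module and its irreducible torsion polynomials -/

section Carlitz

variable {k : Type*} [Field k] [Fintype k] {S : Type*} [CommRing S]

/-- The coefficients of the twisted polynomial `θ + τ`, which defines the Carlitz module. -/
def carlitzCoeff (θ : S) (j : ℕ) : S := if j = 0 then θ else 1

variable [Algebra k S]

theorem twistedOp_carlitzCoeff_apply (θ x : S) :
    twistedOp k (carlitzCoeff θ) 1 x = θ * x + x ^ Fintype.card k := by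
  simp [twistedOp_apply, Finset.sum_range_succ, carlitzCoeff]

variable (k) in
theorem add_pow_fintypeCard (x y : S) :
    (x + y) ^ Fintype.card k = x ^ Fintype.card k + y ^ Fintype.card k := by
  simpa using map_add (FiniteField.frobeniusAlgHom k S) x y

theorem coeff_pow_fintypeCard (P : S[X]) (m : ℕ) :
    (P ^ Fintype.card k).coeff m =
      if Fintype.card k ∣ m then P.coeff (m / Fintype.card k) ^ Fintype.card k else 0 := by
  have hq : 0 < Fintype.card k := Fintype.card_pos
  induction P using Polynomial.induction_on' with
  | add p q hp hq' =>
    rw [add_pow_fintypeCard, coeff_add, hp, hq']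
    split_ifs
    · rw [coeff_add, add_pow_fintypeCard]
    · simp
  | monomial n s =>
    rw [monomial_pow, coeff_monomial, coeff_monomial]
    by_cases h : Fintype.card k ∣ m
    · obtain ⟨j, rfl⟩ := h
      rw [mul_comm n, if_pos (dvd_mul_right _ _), Nat.mul_div_cancel_left _ hq]
      by_cases hj : n = j
      · simp [hj]
      · rw [if_neg hj, if_neg (fun h => hj (Nat.eq_of_mul_eq_mul_left hq h)), zero_pow hq.ne']
    · rw [if_neg h, if_neg]
      rintro rfl
      exact h (dvd_mul_left _ _)

variable (k) in
/-- The polynomials `Σ c_i X ^ (q ^ i)` which, as twisted polynomials `Σ c_i τ ^ i`, commute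
with `θ + τ`. -/
def carlitzCommutant (θ : S) : Submodule k S[X] where
  carrier := {P | (∀ m, (∀ i, m ≠ Fintype.card k ^ i) → P.coeff m = 0) ∧
    ∀ i, P.coeff (Fintype.card k ^ (i + 1)) * θ ^ Fintype.card k ^ (i + 1) +
      P.coeff (Fintype.card k ^ i) =
      θ * P.coeff (Fintype.card k ^ (i + 1)) + P.coeff (Fintype.card k ^ i) ^ Fintype.card k}
  add_mem' {P Q} hP hQ := by
    refine ⟨fun m hm => by rw [coeff_add, hP.1 m hm, hQ.1 m hm, add_zero], fun i => ?_⟩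
    rw [coeff_add, coeff_add, add_pow_fintypeCard]
    linear_combination hP.2 i + hQ.2 i
  zero_mem' := ⟨fun _ _ => coeff_zero _, fun i => by simp⟩
  smul_mem' s P hP := by
    refine ⟨fun m hm => by rw [coeff_smul, hP.1 m hm, smul_zero], fun i => ?_⟩
    rw [coeff_smul, coeff_smul, _root_.smul_pow, FiniteField.pow_card, smul_mul_assoc,
      ← smul_add, hP.2, smul_add, mul_smul_comm]

theorem twistedOp_mem_carlitzCommutant (θ : S) {P : S[X]} (hP : P ∈ carlitzCommutant k θ) :
    twistedOp k (fun j => C (carlitzCoeff θ j)) 1 P ∈ carlitzCommutant k θ := by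
  have hq : 1 < Fintype.card k := Fintype.one_lt_card
  have hcoeff m : (twistedOp k (fun j => C (carlitzCoeff θ j)) 1 P).coeff m = θ * P.coeff m +
      if Fintype.card k ∣ m then P.coeff (m / Fintype.card k) ^ Fintype.card k else 0 := by
    rw [← coeff_pow_fintypeCard, ← coeff_C_mul, ← coeff_add]
    simp [twistedOp_apply, Finset.sum_range_succ, carlitzCoeff]
  have h1 : ¬ Fintype.card k ∣ 1 := fun h => hq.ne' (Nat.dvd_one.1 h)
  have h2 i : Fintype.card k ^ (i + 1) / Fintype.card k = Fintype.card k ^ i := by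
    rw [pow_succ, Nat.mul_div_cancel _ (by omega)]
  refine ⟨fun m hm => ?_, fun i => ?_⟩
  · rw [hcoeff, hP.1 m hm, mul_zero, zero_add]
    split_ifs with h
    · obtain ⟨j, rfl⟩ := h
      rw [Nat.mul_div_cancel_left _ (by omega), hP.1 j, zero_pow (by omega)]
      rintro i rfl
      exact hm (i + 1) (pow_succ' _ _).symm
    · rfl
  · rw [hcoeff, hcoeff, if_pos (dvd_pow_self _ (by omega)), h2]
    cases i with
    | zero =>
      have := hP.2 0
      rw [pow_zero, if_neg h1, add_zero, mul_pow]
      rw [pow_zero, zero_add, pow_one] at this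
      rw [zero_add, pow_one]
      linear_combination θ * this
    | succ i =>
      have h3 := hP.2 (i + 1)
      have h4 := congrArg (fun x => x ^ Fintype.card k) (hP.2 i)
      simp only [add_pow_fintypeCard, mul_pow, ← pow_mul, ← pow_succ] at h4
      rw [if_pos (dvd_pow_self _ (by omega)), h2, add_pow_fintypeCard, mul_pow, ← pow_mul]
      linear_combination θ * h3 + h4

theorem twistedPoly_carlitzCoeff_mem (θ : S) (a : k[X]) :
    twistedPoly k (carlitzCoeff θ) 1 a ∈ carlitzCommutant k θ := by
  have hq : 1 < Fintype.card k := Fintype.one_lt_card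
  refine aeval_end_apply_mem (carlitzCommutant k θ)
    (fun _ h => twistedOp_mem_carlitzCommutant θ h) a (v := (X : S[X]))
    ⟨fun m hm => coeff_X_of_ne_one (by simpa using hm 0), fun i => ?_⟩
  have h1 : Fintype.card k ^ (i + 1) ≠ 1 := (Nat.one_lt_pow (by omega) hq).ne'
  rw [coeff_X_of_ne_one h1]
  cases i with
  | zero => simp
  | succ i =>
    rw [coeff_X_of_ne_one (Nat.one_lt_pow (by omega) hq).ne', zero_pow (by omega)]
    ring

variable (k) in
/-- The polynomial over `k[θ]` of the action of `a` on the Carlitz module; the outer variable is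
the argument. -/
noncomputable def carlitzPoly (a : k[X]) : k[X][X] := twistedPoly k (carlitzCoeff X) 1 a

theorem carlitzPoly_coeff_one (a : k[X]) : (carlitzPoly k a).coeff 1 = a := by
  have h := congrArg (fun P : k[X][X] => P.coeff 0)
    (derivative_twistedPoly (k := k) (carlitzCoeff X) 1 a)
  simpa [coeff_derivative, carlitzCoeff, carlitzPoly] using h

theorem carlitzPoly_coeff_zero (a : k[X]) : (carlitzPoly k a).coeff 0 = 0 :=
  (twistedPoly_carlitzCoeff_mem X a).1 0 fun _ => (pow_pos Fintype.card_pos _).ne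

theorem natDegree_carlitzPoly {a : k[X]} (ha : a ≠ 0) :
    (carlitzPoly k a).natDegree = Fintype.card k ^ a.natDegree := by
  rw [carlitzPoly, (natDegree_twistedPoly_and_monic one_ne_zero (by simp [carlitzCoeff]) ha).1,
    one_mul]

theorem monic_carlitzPoly {a : k[X]} (ha : a.Monic) : (carlitzPoly k a).Monic :=
  (natDegree_twistedPoly_and_monic one_ne_zero (by simp [carlitzCoeff]) ha.ne_zero).2
    (by simp [carlitzCoeff]) ha

/-- All coefficients but the leading one of the polynomial of a prime `ℓ` are divisible by `ℓ`:
consecutive coefficients satisfy `c_{i+1} (θ ^ q ^ (i+1) - θ) = c_i ^ q - c_i`, where `c_0 = ℓ`, and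
`ℓ` does not divide `θ ^ q ^ (i+1) - θ` as long as `i + 1 < deg ℓ`. -/
theorem dvd_coeff_carlitzPoly {ℓ : k[X]} (hℓ : Irreducible ℓ) {m : ℕ}
    (hm : m < Fintype.card k ^ ℓ.natDegree) : ℓ ∣ (carlitzPoly k ℓ).coeff m := by
  have hq : 1 < Fintype.card k := Fintype.one_lt_card
  have hmem : carlitzPoly k ℓ ∈ carlitzCommutant k X := twistedPoly_carlitzCoeff_mem X ℓ
  by_cases h : ∀ i, m ≠ Fintype.card k ^ i
  · rw [hmem.1 m h]
    exact dvd_zero _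
  push Not at h
  obtain ⟨i, rfl⟩ := h
  replace hm : i < ℓ.natDegree := (Nat.pow_lt_pow_iff_right hq).1 hm
  induction i with
  | zero =>
    rw [pow_zero, carlitzPoly_coeff_one]
  | succ i ih =>
    have h1 : (carlitzPoly k ℓ).coeff (Fintype.card k ^ (i + 1)) *
        (X ^ Fintype.card k ^ (i + 1) - X) = (carlitzPoly k ℓ).coeff (Fintype.card k ^ i) ^
          Fintype.card k - (carlitzPoly k ℓ).coeff (Fintype.card k ^ i) := by
      linear_combination hmem.2 i
    have h2 : ℓ ∣ (carlitzPoly k ℓ).coeff (Fintype.card k ^ (i + 1)) *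
        (X ^ Fintype.card k ^ (i + 1) - X) := by
      rw [h1]
      exact dvd_sub (dvd_pow (ih (by omega)) (by omega)) (ih (by omega))
    refine (hℓ.prime.dvd_or_dvd h2).resolve_right fun h3 => ?_
    rw [← Nat.card_eq_fintype_card] at h3
    have := Nat.le_of_dvd (by omega) (hℓ.natDegree_dvd_of_dvd_X_pow_card_pow_sub_X h3)
    omega

/-- Modulo a prime `ℓ` of degree `d`, the polynomial of `ℓ` is `X ^ (q ^ d)`. -/
theorem map_mk_carlitzPoly {ℓ : k[X]} (hℓ : Irreducible ℓ) (hm : ℓ.Monic) :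
    (carlitzPoly k ℓ).map (Ideal.Quotient.mk (Ideal.span {ℓ})) =
      X ^ Fintype.card k ^ ℓ.natDegree := by
  ext m
  rw [coeff_map, coeff_X_pow]
  rcases lt_trichotomy m (Fintype.card k ^ ℓ.natDegree) with h | h | h
  · rw [if_neg h.ne, Ideal.Quotient.eq_zero_iff_dvd]
    exact dvd_coeff_carlitzPoly hℓ h
  · have := (monic_carlitzPoly hm).coeff_natDegree
    rw [natDegree_carlitzPoly hm.ne_zero, ← h] at this
    rw [if_pos h, this, map_one]
  · rw [if_neg h.ne', coeff_eq_zero_of_natDegree_lt, map_zero]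
    rwa [natDegree_carlitzPoly hm.ne_zero]

theorem carlitzPoly_mul (a b : k[X]) :
    carlitzPoly k (a * b) = (carlitzPoly k a).comp (carlitzPoly k b) :=
  twistedPoly_mul _ _ a b

theorem map_mk_carlitzPoly_pow {ℓ : k[X]} (hℓ : Irreducible ℓ) (hm : ℓ.Monic) (n : ℕ) :
    (carlitzPoly k (ℓ ^ n)).map (Ideal.Quotient.mk (Ideal.span {ℓ})) =
      X ^ Fintype.card k ^ (n * ℓ.natDegree) := by
  induction n with
  | zero => simp [carlitzPoly, twistedPoly]
  | succ n ih =>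
    rw [pow_succ', carlitzPoly_mul, map_comp, ih, map_mk_carlitzPoly hℓ hm, X_pow_comp, ← pow_mul,
      ← pow_add, add_mul, one_mul]

/-- The polynomial whose roots are the generators of the `ℓ ^ (n + 1)`-torsion of the Carlitz
module is Eisenstein at `ℓ`, hence irreducible. -/
theorem irreducible_carlitzPoly_divX_comp {ℓ : k[X]} (hℓ : Irreducible ℓ) (hm : ℓ.Monic) (n : ℕ) :
    ((carlitzPoly k ℓ).divX.comp (carlitzPoly k (ℓ ^ n))).Monic ∧
    Irreducible ((carlitzPoly k ℓ).divX.comp (carlitzPoly k (ℓ ^ n))) := by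
  have hq : 1 < Fintype.card k := Fintype.one_lt_card
  have hd : 1 < Fintype.card k ^ ℓ.natDegree := Nat.one_lt_pow hℓ.natDegree_pos.ne' hq
  have hdeg1 : (carlitzPoly k ℓ).divX.natDegree = Fintype.card k ^ ℓ.natDegree - 1 := by
    rw [natDegree_divX_eq_natDegree_tsub_one, natDegree_carlitzPoly hm.ne_zero]
  have hmon1 : (carlitzPoly k ℓ).divX.Monic := by
    have := (monic_carlitzPoly hm).coeff_natDegree
    rw [natDegree_carlitzPoly hm.ne_zero] at this
    rw [Monic, leadingCoeff, hdeg1, coeff_divX, Nat.sub_add_cancel hd.le, this]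
  have hdeg2 : (carlitzPoly k (ℓ ^ n)).natDegree = Fintype.card k ^ (n * ℓ.natDegree) := by
    rw [natDegree_carlitzPoly (hm.pow n).ne_zero, natDegree_pow]
  have hpos : 0 < Fintype.card k ^ (n * ℓ.natDegree) := pow_pos (by omega) _
  have hmon : ((carlitzPoly k ℓ).divX.comp (carlitzPoly k (ℓ ^ n))).Monic :=
    hmon1.comp (monic_carlitzPoly (hm.pow n)) (by rw [hdeg2]; omega)
  refine ⟨hmon, ?_⟩
  have hprime : (Ideal.span {ℓ}).IsPrime :=
    (Ideal.span_singleton_prime hℓ.ne_zero).2 hℓ.prime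
  -- Modulo `ℓ` both factors of the composition are powers of `X`; its constant coefficient is `ℓ`.
  have hmap : (carlitzPoly k ℓ).divX.map (Ideal.Quotient.mk (Ideal.span {ℓ})) =
      X ^ (Fintype.card k ^ ℓ.natDegree - 1) := by
    ext m
    rw [coeff_map, coeff_divX, ← coeff_map, map_mk_carlitzPoly hℓ hm, coeff_X_pow, coeff_X_pow]
    congr 1
    simp only [eq_iff_iff]
    omega
  have heis : ((carlitzPoly k ℓ).divX.comp (carlitzPoly k (ℓ ^ n))).IsEisensteinAt
      (Ideal.span {ℓ}) := by
    refine hmon.isEisensteinAt_of_mem_of_notMem hprime.ne_top (fun {m} hlt => ?_) ?_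
    · rw [← Ideal.Quotient.eq_zero_iff_mem, ← coeff_map, map_comp, hmap,
        map_mk_carlitzPoly_pow hℓ hm, X_pow_comp, ← pow_mul, coeff_X_pow, if_neg]
      rw [natDegree_comp, hdeg1, hdeg2, mul_comm] at hlt
      exact hlt.ne
    · rw [coeff_zero_eq_eval_zero, eval_comp, ← coeff_zero_eq_eval_zero, carlitzPoly_coeff_zero,
        ← coeff_zero_eq_eval_zero, coeff_divX, zero_add, carlitzPoly_coeff_one,
        Ideal.span_singleton_pow, Ideal.mem_span_singleton, sq]
      intro h
      exact hℓ.not_isUnit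
        (isUnit_of_dvd_one ((mul_dvd_mul_iff_left hℓ.ne_zero).1 (by rwa [mul_one])))
  refine heis.irreducible hprime hmon.isPrimitive ?_
  rw [natDegree_comp, hdeg1, hdeg2]
  exact Nat.mul_pos (by omega) hpos

/-- The Galois group permutes the generators of the `ℓ ^ (n + 1)`-torsion of the Carlitz module
transitively. -/
theorem exists_algEquiv_carlitz {F L : Type*} [Field F] [Algebra k[X] F] [IsFractionRing k[X] F]
    [Field L] [Algebra k L] [Algebra k[X] L] [IsScalarTower k k[X] L] [Algebra F L]
    [IsScalarTower k[X] F L] [Normal F L] {ℓ : k[X]} (hℓ : Irreducible ℓ) {n : ℕ} {u : L}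
    (h1 : aeval (twistedOp k (carlitzCoeff (algebraMap k[X] L X)) 1) (ℓ ^ (n + 1)) u = 0)
    (h2 : aeval (twistedOp k (carlitzCoeff (algebraMap k[X] L X)) 1) (ℓ ^ n) u ≠ 0)
    {β : k[X]} (hβ : ¬ ℓ ∣ β) :
    ∃ σ : L ≃ₐ[F] L, σ u = aeval (twistedOp k (carlitzCoeff (algebraMap k[X] L X)) 1) β u := by
  set D := twistedOp k (carlitzCoeff (algebraMap k[X] L X)) 1 with hD
  -- The torsion of `ℓ` is that of the monic associate `p`, whose polynomial is monic.
  set p := ℓ * C ℓ.leadingCoeff⁻¹ with hp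
  have hpm : p.Monic := monic_mul_leadingCoeff_inv hℓ.ne_zero
  have hpi : Irreducible p := irreducible_mul_leadingCoeff_inv.2 hℓ
  obtain ⟨hmon, hirr⟩ := irreducible_carlitzPoly_divX_comp hpi hpm n
  set Φ := (carlitzPoly k p).divX.comp (carlitzPoly k (p ^ n)) with hΦ
  have hev a (x : L) : (carlitzPoly k a).eval₂ (algebraMap k[X] L) x = aeval D a x :=
    eval₂_twistedPoly (Algebra.ofId k[X] L |>.restrictScalars k)
      (c' := carlitzCoeff (algebraMap k[X] L X))
      (fun j => by
        simp only [carlitzCoeff]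
        split_ifs
        · rfl
        · exact map_one _) 1 a x
  have hroot x (hx1 : aeval D (ℓ ^ (n + 1)) x = 0) (hx2 : aeval D (ℓ ^ n) x ≠ 0) :
      Φ.eval₂ (algebraMap k[X] L) x = 0 := by
    rw [← aeval_mul_leadingCoeff_inv_pow_eq_zero_iff hℓ.ne_zero, pow_succ', ← hev,
      carlitzPoly_mul, ← hp] at hx1
    rw [Ne, ← aeval_mul_leadingCoeff_inv_pow_eq_zero_iff hℓ.ne_zero, ← hev, ← hp] at hx2
    rw [← divX_mul_X_add (carlitzPoly k p), carlitzPoly_coeff_zero, C_0, add_zero, mul_comp,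
      X_comp, eval₂_mul] at hx1
    exact (mul_eq_zero.1 hx1).resolve_right hx2
  have hcop : IsCoprime β ℓ := (hℓ.coprime_iff_not_dvd.2 hβ).symm
  have h3 : aeval D (ℓ ^ (n + 1)) (aeval D β u) = 0 := by
    rw [← Module.End.mul_apply, ← map_mul, mul_comm, map_mul, Module.End.mul_apply, h1, map_zero]
  have h4 : aeval D (ℓ ^ n) (aeval D β u) ≠ 0 := by
    intro h
    obtain ⟨r, s, hrs⟩ := hcop
    refine h2 ?_
    have : ℓ ^ n = r * (ℓ ^ n * β) + s * ℓ ^ (n + 1) := by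
      linear_combination -ℓ ^ n * hrs
    rw [this, map_add, map_mul, map_mul, map_mul, LinearMap.add_apply, Module.End.mul_apply,
      Module.End.mul_apply, Module.End.mul_apply, h, h1, map_zero, map_zero, add_zero]
  have hirrF : Irreducible (Φ.map (algebraMap k[X] F)) :=
    (hmon.irreducible_iff_irreducible_map_fraction_map (K := F)).1 hirr
  have hmonF := hmon.map (algebraMap k[X] F)
  have hF x (hx : Φ.eval₂ (algebraMap k[X] L) x = 0) : aeval x (Φ.map (algebraMap k[X] F)) = 0 := by
    rwa [aeval_map_algebraMap]
  have hu := minpoly.eq_of_irreducible_of_monic hirrF (hF _ (hroot u h1 h2)) hmonF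
  refine minpoly.exists_algEquiv_of_root' (Algebra.IsAlgebraic.isAlgebraic u) ?_
  rw [← hu]
  exact hF _ (hroot _ h3 h4)

end Carlitz

/-! ### Frobenius powers of linearly independent elements -/

section Moore

variable {k : Type*} [Field k] [Fintype k] {L : Type*} [Field L] [Algebra k L]

theorem exists_algebraMap_eq_of_pow_fintypeCard_eq {y : L} (hy : y ^ Fintype.card k = y) :
    ∃ s : k, algebraMap k L s = y := by
  have hroots := FiniteField.roots_X_pow_card_sub_X k
  have hdeg := FiniteField.X_pow_card_sub_X_natDegree_eq k (Fintype.one_lt_card (α := k))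
  have hmon : (X ^ Fintype.card k - X : k[X]).Monic :=
    monic_X_pow_sub (by rw [degree_X]; exact_mod_cast Fintype.one_lt_card)
  have hprod := prod_multiset_X_sub_C_of_monic_of_roots_card_eq hmon (by rw [hroots, hdeg]; rfl)
  rw [hroots] at hprod
  have h0 := congrArg (aeval y) hprod
  change aeval y (∏ s : k, (X - C s)) = _ at h0
  simp only [map_prod, map_sub, map_pow, aeval_X, aeval_C, hy, sub_self] at h0
  obtain ⟨s, -, hs⟩ := Finset.prod_eq_zero_iff.1 h0
  exact ⟨s, (sub_eq_zero.1 hs).symm⟩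

/-- Non-vanishing of the Moore determinant, as the independence of the vectors `(x i ^ q ^ j)_j`.
Subtracting `x 0 ^ (q ^ (j + 1) - q ^ j)` times relation `j` from relation `j + 1` gives the same
relations for the elements `x i ^ q - x 0 ^ (q - 1) * x i` with `i ≠ 0`, which are again
independent as `k * x 0` is the kernel of `z ↦ z ^ q - x 0 ^ (q - 1) * z`. -/
theorem eq_zero_of_sum_mul_pow_eq_zero_fin {n : ℕ} {x : Fin n → L} (hx : LinearIndependent k x)
    {c : Fin n → L} (hc : ∀ j, ∑ i, c i * x i ^ Fintype.card k ^ j = 0) : c = 0 := by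
  have hq : 1 < Fintype.card k := Fintype.one_lt_card
  induction n with
  | zero => exact Subsingleton.elim _ _
  | succ n ih =>
    have hx0 : x 0 ≠ 0 := hx.ne_zero 0
    let P : L →ₗ[k] L := (FiniteField.frobeniusAlgHom k L).toLinearMap -
      Algebra.lmul k L (x 0 ^ (Fintype.card k - 1))
    have hP z : P z = z ^ Fintype.card k - x 0 ^ (Fintype.card k - 1) * z := by simp [P]
    have hind : LinearIndependent k fun i : Fin n => P (x i.succ) := by
      rw [Fintype.linearIndependent_iff]
      intro γ hγ
      simp only [← map_smul, ← map_sum] at hγ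
      set z := ∑ i, γ i • x i.succ with hz
      rw [hP, sub_eq_zero] at hγ
      have hfix : (z / x 0) ^ Fintype.card k = z / x 0 := by
        rw [div_pow, hγ, div_eq_div_iff (pow_ne_zero _ hx0) hx0, mul_right_comm, ← pow_succ,
          Nat.sub_add_cancel hq.le, mul_comm]
      obtain ⟨s, hs⟩ := exists_algebraMap_eq_of_pow_fintypeCard_eq hfix
      rw [eq_div_iff hx0, ← Algebra.smul_def] at hs
      have := Fintype.linearIndependent_iff.1 hx (Fin.cons (-s) γ) (by
        rw [Fin.sum_univ_succ]
        simp only [Fin.cons_zero, Fin.cons_succ]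
        rw [← hz, neg_smul, hs, neg_add_cancel])
      intro i
      simpa using this i.succ
    have htail := ih hind (c := fun i => c i.succ) (fun j => by
      have h1 := hc (j + 1)
      have h2 := hc j
      rw [Fin.sum_univ_succ] at h1 h2
      have h3 i : c (Fin.succ i) * P (x i.succ) ^ Fintype.card k ^ j =
          c i.succ * x i.succ ^ Fintype.card k ^ (j + 1) -
            x 0 ^ ((Fintype.card k - 1) * Fintype.card k ^ j) *
              (c i.succ * x i.succ ^ Fintype.card k ^ j) := by
        have h4 := map_sub ((FiniteField.frobeniusAlgHom k L).toLinearMap ^ j : Module.End k L)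
          (x i.succ ^ Fintype.card k) (x 0 ^ (Fintype.card k - 1) * x i.succ)
        rw [← hP] at h4
        simp only [frobeniusAlgHom_toLinearMap_pow_apply] at h4
        rw [h4, pow_succ', mul_pow, ← pow_mul, ← pow_mul]
        ring
      have h5 : x 0 ^ Fintype.card k ^ (j + 1) =
          x 0 ^ ((Fintype.card k - 1) * Fintype.card k ^ j) * x 0 ^ Fintype.card k ^ j := by
        rw [← pow_add, pow_succ']
        congr 1
        rw [← Nat.succ_mul, Nat.succ_eq_add_one, Nat.sub_add_cancel hq.le]
      simp only [h3, Finset.sum_sub_distrib, ← Finset.mul_sum]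
      rw [h5] at h1
      linear_combination h1 - x 0 ^ ((Fintype.card k - 1) * Fintype.card k ^ j) * h2)
    have hsucc i : c (Fin.succ i) = 0 := congrFun htail i
    have h0 := hc 0
    rw [Fin.sum_univ_succ] at h0
    simp only [hsucc, zero_mul, Finset.sum_const_zero, add_zero, pow_zero, pow_one] at h0
    funext i
    refine Fin.cases ?_ hsucc i
    exact (mul_eq_zero.1 h0).resolve_right hx0

theorem eq_zero_of_sum_mul_pow_eq_zero {ι : Type*} [Fintype ι] {x : ι → L}
    (hx : LinearIndependent k x) {c : ι → L}
    (hc : ∀ j, ∑ i, c i * x i ^ Fintype.card k ^ j = 0) : c = 0 := by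
  let e := (Fintype.equivFin ι).symm
  have h := eq_zero_of_sum_mul_pow_eq_zero_fin (hx.comp e e.injective) (c := c ∘ e) (fun j => by
    rw [← hc j]
    exact Equiv.sum_comp e (fun i => c i * x i ^ Fintype.card k ^ j))
  funext i
  simpa using congrFun h (e.symm i)

end Moore

/-! ### Coefficient extensions of Frobenius algebras -/

section Pairing

variable {k : Type*} [Field k] {L : Type*} [Field L] [Algebra k L]
  {B : Type*} [CommRing B] [Algebra k B] (lam : B →ₗ[k] k)

variable (L) in
/-- The `L`-linear map `L ⊗ B → Hom_k(B, L)` which sends `y ⊗ b` to `b' ↦ λ(b b') y`, for a linear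
form `λ` on `B`. -/
noncomputable def toHom : L ⊗[k] B →ₗ[L] (B →ₗ[k] L) :=
  ((LinearMap.mul k B).compr₂ (Algebra.linearMap k L ∘ₗ lam)).liftBaseChange L

theorem toHom_tmul (y : L) (b b' : B) :
    toHom L lam (y ⊗ₜ b) b' = y * algebraMap k L (lam (b * b')) := by
  simp [toHom]

theorem toHom_one_tmul_mul (b b' : B) (r : L ⊗[k] B) :
    toHom L lam ((1 ⊗ₜ b) * r) b' = toHom L lam r (b * b') := by
  induction r with
  | zero => simp
  | tmul y c =>
    rw [Algebra.TensorProduct.tmul_mul_tmul, toHom_tmul, toHom_tmul, one_mul, mul_right_comm,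
      mul_comm c, mul_right_comm]
  | add r s hr hs =>
    rw [mul_add, map_add, map_add, LinearMap.add_apply, LinearMap.add_apply, hr, hs]

theorem toHom_tmul_one_mul (y : L) (b' : B) (r : L ⊗[k] B) :
    toHom L lam ((y ⊗ₜ 1) * r) b' = y * toHom L lam r b' := by
  have h : (y ⊗ₜ 1) * r = y • r := by
    rw [Algebra.smul_def]
    rfl
  rw [h, map_smul, LinearMap.smul_apply, smul_eq_mul]

variable (B) in
/-- The extension of a `k`-algebra endomorphism of `L` to `L ⊗ B`, acting on the coefficients. -/
noncomputable abbrev mapCoeff (s : L →ₐ[k] L) : L ⊗[k] B →ₐ[k] L ⊗[k] B :=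
  Algebra.TensorProduct.map s (AlgHom.id k B)

theorem toHom_mapCoeff (s : L →ₐ[k] L) (r : L ⊗[k] B) (b' : B) :
    toHom L lam (mapCoeff B s r) b' = s (toHom L lam r b') := by
  induction r with
  | zero => simp
  | tmul y c => simp [toHom_tmul]
  | add r s hr hs => simp only [map_add, LinearMap.add_apply, hr, hs]

/-- If `λ` vanishes on no nonzero ideal of `B`, then `B` is self-dual, hence
`L ⊗ B ≃ Hom_k(B, L)`. -/
theorem toHom_bijective [FiniteDimensional k B] (hlam : ∀ b, (∀ b', lam (b * b') = 0) → b = 0) :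
    Function.Bijective (toHom L lam) := by
  let β : LinearMap.BilinForm k B := (LinearMap.mul k B).compr₂ lam
  have hβ : β.Nondegenerate := by
    refine ⟨fun b hb => hlam b hb, fun b hb => hlam b fun b' => ?_⟩
    rw [mul_comm]
    exact hb b'
  let e : L ⊗[k] B ≃ₗ[k] (B →ₗ[k] L) := TensorProduct.comm k L B ≪≫ₗ
    TensorProduct.congr (β.toDual hβ) (LinearEquiv.refl k L) ≪≫ₗ dualTensorHomEquiv k B L
  have he : (toHom L lam : L ⊗[k] B → (B →ₗ[k] L)) = e := by
    funext r
    induction r with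
    | zero => simp
    | tmul y c =>
      ext b'
      simp [e, toHom_tmul, β, LinearMap.BilinForm.toDual_def, Algebra.smul_def, mul_comm]
    | add r s hr hs => rw [map_add, map_add, hr, hs]
  rw [he]
  exact e.bijective

end Pairing

/-! ### The determinant of solutions of a Frobenius-difference equation -/

section Casorati

theorem isUnit_det_of_vecMul_injective {R : Type*} [CommRing R] [IsArtinianRing R] {n : Type*}
    [Fintype n] [DecidableEq n] (Y : Matrix n n R) (hY : ∀ v, Matrix.vecMul v Y = 0 → v = 0) :
    IsUnit Y.det := by
  have hinj : Function.Injective Y.vecMulLinear := by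
    rw [injective_iff_map_eq_zero]
    exact hY
  have hsurj := IsArtinian.surjective_of_injective_endomorphism _ hinj
  rw [← Matrix.isUnit_iff_isUnit_det, ← Matrix.vecMul_surjective_iff_isUnit]
  exact hsurj

variable {k : Type*} [Field k] [Fintype k] {L : Type*} [Field L] [Algebra k L]
  {B : Type*} [CommRing B] [Algebra k B]

variable (k L B) in
/-- The Frobenius of `L`, acting on the coefficients of `L ⊗ B`. -/
noncomputable abbrev frobCoeff : L ⊗[k] B →ₐ[k] L ⊗[k] B :=
  mapCoeff B (FiniteField.frobeniusAlgHom k L)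

variable (k) in
/-- The Casorati matrix of elements of `L ⊗ B`: its columns are their Frobenius conjugates. -/
noncomputable def casorati {r : ℕ} (F : Fin r → L ⊗[k] B) : Matrix (Fin r) (Fin r) (L ⊗[k] B) :=
  Matrix.of fun i j => (frobCoeff k L B)^[j] (F i)

theorem toHom_frobCoeff_iterate (lam : B →ₗ[k] k) (j : ℕ) (r : L ⊗[k] B) (b : B) :
    toHom L lam ((frobCoeff k L B)^[j] r) b = toHom L lam r b ^ Fintype.card k ^ j := by
  induction j with
  | zero => simp
  | succ j ih =>
    rw [Function.iterate_succ_apply', toHom_mapCoeff, ih, pow_succ, pow_mul]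
    rfl

theorem frobCoeff_iterate_tmul (j : ℕ) (y : L) (b : B) :
    (frobCoeff k L B)^[j] (y ⊗ₜ b) = (y ^ Fintype.card k ^ j) ⊗ₜ b := by
  induction j with
  | zero => simp
  | succ j ih =>
    rw [Function.iterate_succ_apply', ih, pow_succ, pow_mul]
    simp

/-- The Frobenius conjugate of the Casorati determinant of solutions of a difference equation of
order `3` is obtained by replacing the column `F'''` through the equation and moving `F` to the
front, which is an even permutation. -/
theorem casorati_det_equation {c : ℕ → L} {t : B} {F : Fin 3 → L ⊗[k] B}
    (hF : ∀ i, ((1 : L) ⊗ₜ[k] t - c 0 ⊗ₜ[k] (1 : B)) * F i = ∑ j ∈ Finset.range 3,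
      (c (j + 1) ⊗ₜ[k] (1 : B)) * (frobCoeff k L B)^[j + 1] (F i)) :
    (c 3 ⊗ₜ[k] (1 : B)) * frobCoeff k L B (casorati k F).det =
      ((1 : L) ⊗ₜ[k] t - c 0 ⊗ₜ[k] (1 : B)) * (casorati k F).det := by
  have h0 := hF 0
  have h1 := hF 1
  have h2 := hF 2
  simp only [Finset.sum_range_succ, Finset.sum_range_zero, zero_add, Function.iterate_succ,
    Function.iterate_zero, Function.comp_apply, id_eq] at h0 h1 h2
  simp only [casorati, Matrix.det_fin_three, Matrix.of_apply, Fin.val_zero, Fin.val_one,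
    Fin.val_two, Function.iterate_succ, Function.iterate_zero, Function.comp_apply, id_eq,
    map_sub, map_add, map_mul]
  generalize frobCoeff k L B = τ at *
  linear_combination
    (-(τ (F 1) * τ (τ (F 2)) - τ (F 2) * τ (τ (F 1)))) * h0 +
    (τ (F 0) * τ (τ (F 2)) - τ (F 2) * τ (τ (F 0))) * h1 -
    (τ (F 0) * τ (τ (F 1)) - τ (F 1) * τ (τ (F 0))) * h2

/-- The Casorati determinant of solutions is a unit as soon as the corresponding maps `B → L` are
independent over `B`: an `L ⊗ B`-linear relation between the rows of the Casorati matrix propagates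
to all Frobenius conjugates, and contradicts the non-vanishing of a Moore determinant. -/
theorem isUnit_det_casorati [FiniteDimensional k B] (lam : B →ₗ[k] k) {c : ℕ → L} (hc : c 3 ≠ 0)
    {t : B} {F : Fin 3 → L ⊗[k] B}
    (hF : ∀ i, ((1 : L) ⊗ₜ[k] t - c 0 ⊗ₜ[k] (1 : B)) * F i = ∑ j ∈ Finset.range 3,
      (c (j + 1) ⊗ₜ[k] (1 : B)) * (frobCoeff k L B)^[j + 1] (F i))
    (hind : ∀ β : Fin 3 → B, ∑ i, toHom L lam (F i) (β i) = 0 → β = 0) :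
    IsUnit (casorati k F).det := by
  have : IsArtinianRing (L ⊗[k] B) := IsArtinianRing.of_finite L _
  refine isUnit_det_of_vecMul_injective _ fun v hv => ?_
  have hiter j (r s : L ⊗[k] B) : (frobCoeff k L B)^[j] (r * s) =
      (frobCoeff k L B)^[j] r * (frobCoeff k L B)^[j] s := by
    rw [← AlgHom.coe_pow, map_mul]
  -- The equation, conjugated `j` times, expresses the conjugate `j + 3` through the previous ones.
  have hrel : ∀ j, ∑ i, v i * (frobCoeff k L B)^[j] (F i) = 0 := by
    intro j
    induction j using Nat.strong_induction_on with
    | _ j ih =>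
      by_cases hj : j < 3
      · have := congrFun hv ⟨j, hj⟩
        simpa [Matrix.vecMul, dotProduct, casorati] using this
      · obtain ⟨j, rfl⟩ : ∃ j', j = j' + 3 := ⟨j - 3, by omega⟩
        have hF' i := congrArg (frobCoeff k L B)^[j] (hF i)
        simp only [Finset.sum_range_succ, Finset.sum_range_zero, zero_add, hiter,
          ← AlgHom.coe_pow, map_add, map_sub] at hF'
        simp only [AlgHom.coe_pow, hiter, frobCoeff_iterate_tmul, ← Function.iterate_add_apply]
          at hF'
        have h0 := ih j (by omega)
        have h1 := ih (j + 1) (by omega)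
        have h2 := ih (j + 2) (by omega)
        have hunit : IsUnit ((c 3 ^ Fintype.card k ^ j) ⊗ₜ[k] (1 : B)) :=
          ((pow_ne_zero _ hc).isUnit).map (Algebra.TensorProduct.includeLeft (R := k) (S := L))
        refine hunit.mul_right_eq_zero.1 ?_
        simp only [Fin.sum_univ_three] at h0 h1 h2 ⊢
        linear_combination
          ((1 ^ Fintype.card k ^ j : L) ⊗ₜ[k] t - (c 0 ^ Fintype.card k ^ j) ⊗ₜ[k] (1 : B)) * h0 -
          ((c 1 ^ Fintype.card k ^ j) ⊗ₜ[k] (1 : B)) * h1 -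
          ((c 2 ^ Fintype.card k ^ j) ⊗ₜ[k] (1 : B)) * h2 -
          v 0 * hF' 0 - v 1 * hF' 1 - v 2 * hF' 2
  let b := Module.finBasis k B
  let bL := Algebra.TensorProduct.basis L b
  have hli : LinearIndependent k fun p : Fin 3 × Fin (Module.finrank k B) =>
      toHom L lam (F p.1) (b p.2) := by
    rw [Fintype.linearIndependent_iff]
    intro γ hγ
    rw [Fintype.sum_prod_type] at hγ
    simp only [← map_smul, ← map_sum] at hγ
    have := hind _ hγ
    rintro ⟨i, s⟩
    exact Fintype.linearIndependent_iff.1 b.linearIndependent (fun s => γ (i, s))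
      (congrFun this i) s
  -- The form `r ↦ toHom L lam r 1` turns the relations into relations between powers in `L`.
  have hzero := eq_zero_of_sum_mul_pow_eq_zero hli (c := fun p => bL.repr (v p.1) p.2) (fun j => by
    have hj := congrArg (fun r => toHom L lam r 1) (hrel j)
    simp only [map_zero, LinearMap.zero_apply, map_sum, LinearMap.sum_apply] at hj
    rw [← hj, Fintype.sum_prod_type]
    refine Finset.sum_congr rfl fun i _ => ?_
    conv_rhs => rw [← bL.sum_repr (v i)]
    rw [Finset.sum_mul, map_sum, LinearMap.sum_apply]
    refine Finset.sum_congr rfl fun s _ => ?_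
    rw [smul_mul_assoc, map_smul, LinearMap.smul_apply, Algebra.TensorProduct.basis_apply,
      toHom_one_tmul_mul, toHom_frobCoeff_iterate, mul_one, smul_eq_mul])
  funext i
  refine bL.repr.map_eq_zero_iff.1 (Finsupp.ext fun s => ?_)
  exact congrFun hzero (i, s)

/-- The Weil pairing. Let `f i` be three `B`-independent maps `B → L` along which `t` acts as the
operator `c 0 + c 1 τ + c 2 τ ^ 2 + c 3 τ ^ 3`, where `c 3 = c 0 ^ (q - 1)`. There is a map `h`
along which `t` acts as the operator `c 0 + τ` of the Carlitz module and which every automorphism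
multiplies by the determinant of its action on the `f i`. It comes from `c 0` times the Casorati
determinant. -/
theorem exists_carlitz_of_casorati [FiniteDimensional k B] (lam : B →ₗ[k] k)
    (hlam : ∀ b, (∀ b', lam (b * b') = 0) → b = 0) {c : ℕ → L} (hc0 : c 0 ≠ 0)
    (hc3 : c 3 = c 0 ^ (Fintype.card k - 1)) {t : B} {f : Fin 3 → B →ₗ[k] L}
    (hf : ∀ i b, f i (t * b) = twistedOp k c 3 (f i b))
    (hind : ∀ β : Fin 3 → B, ∑ i, f i (β i) = 0 → β = 0) :
    ∃ h : B →ₗ[k] L, (∀ b, h (t * b) = c 0 * h b + h b ^ Fintype.card k) ∧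
      (∀ b, (∀ b', h (b * b') = 0) → b = 0) ∧
      ∀ (σ : L →ₐ[k] L) (m : Matrix (Fin 3) (Fin 3) B), σ (c 0) = c 0 →
        (∀ i b, σ (f i b) = ∑ j, f j (m i j * b)) → ∀ b, σ (h b) = h (m.det * b) := by
  have hbij := toHom_bijective (L := L) lam hlam
  choose F hF using fun i => hbij.2 (f i)
  have hext {r s : L ⊗[k] B} (h : ∀ b, toHom L lam r b = toHom L lam s b) : r = s :=
    hbij.1 (LinearMap.ext h)
  have heq i : ((1 : L) ⊗ₜ[k] t - c 0 ⊗ₜ[k] (1 : B)) * F i = ∑ j ∈ Finset.range 3,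
      (c (j + 1) ⊗ₜ[k] (1 : B)) * (frobCoeff k L B)^[j + 1] (F i) := by
    refine hext fun b => ?_
    rw [sub_mul, map_sub, LinearMap.sub_apply, toHom_one_tmul_mul, toHom_tmul_one_mul, hF, hf,
      twistedOp_apply, Finset.sum_range_succ', pow_zero, pow_one, add_sub_cancel_right, map_sum,
      LinearMap.sum_apply]
    refine Finset.sum_congr rfl fun j _ => ?_
    rw [toHom_tmul_one_mul, toHom_frobCoeff_iterate, hF]
  have hW := casorati_det_equation heq
  have hunit := isUnit_det_casorati lam (hc3 ▸ pow_ne_zero _ hc0) heq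
    (fun β h => hind β (by simpa only [hF] using h))
  set W := (casorati k F).det with hWdef
  -- The conjugate of `c 0` is `c 0 * c 3`, so the factor `c 0` absorbs the coefficient `c 3`.
  set U := (c 0 ⊗ₜ[k] (1 : B)) * W with hU
  have hUunit : IsUnit U := IsUnit.mul
    (hc0.isUnit.map (Algebra.TensorProduct.includeLeft (R := k) (S := L))) hunit
  have hUeq : ((1 : L) ⊗ₜ[k] t) * U = (c 0 ⊗ₜ[k] (1 : B)) * U + frobCoeff k L B U := by
    have h1 : frobCoeff k L B (c 0 ⊗ₜ[k] (1 : B)) = (c 0 ⊗ₜ[k] (1 : B)) * (c 3 ⊗ₜ[k] (1 : B)) := by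
      rw [Algebra.TensorProduct.tmul_mul_tmul, mul_one, hc3, ← pow_succ',
        Nat.sub_add_cancel Fintype.card_pos]
      simp
    rw [hU, map_mul, h1]
    linear_combination -(c 0 ⊗ₜ[k] (1 : B)) * hW
  refine ⟨toHom L lam U, fun b => ?_, fun b hb => ?_, fun σ m hσ hm b => ?_⟩
  · rw [← toHom_one_tmul_mul, hUeq, map_add, LinearMap.add_apply, toHom_tmul_one_mul,
      toHom_mapCoeff]
    rfl
  · have h1 : ((1 : L) ⊗ₜ[k] b) * U = 0 := hext fun b' => by
      rw [toHom_one_tmul_mul, hb, map_zero, LinearMap.zero_apply]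
    rw [hUunit.mul_left_eq_zero] at h1
    refine Algebra.TensorProduct.includeRight_injective (R := k) (A := L) (B := B)
      (algebraMap k L).injective ?_
    rw [map_zero]
    exact h1
  · have h1 i : mapCoeff B σ (F i) = ∑ j, ((1 : L) ⊗ₜ[k] m i j) * F j := hext fun b => by
      rw [toHom_mapCoeff, hF, hm, map_sum, LinearMap.sum_apply]
      refine Finset.sum_congr rfl fun j _ => ?_
      rw [toHom_one_tmul_mul, hF]
    have hcomm j r : mapCoeff B σ ((frobCoeff k L B)^[j] r) =
        (frobCoeff k L B)^[j] (mapCoeff B σ r) := hext fun b => by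
      rw [toHom_mapCoeff, toHom_frobCoeff_iterate, toHom_frobCoeff_iterate, toHom_mapCoeff, map_pow]
    have h2 : (mapCoeff B σ).mapMatrix (casorati k F) =
        (Algebra.TensorProduct.includeRight : B →ₐ[k] L ⊗[k] B).mapMatrix m * casorati k F := by
      ext i j : 2
      simp only [AlgHom.mapMatrix_apply, Matrix.map_apply, casorati, Matrix.of_apply,
        Matrix.mul_apply, hcomm, h1, Algebra.TensorProduct.includeRight_apply]
      rw [← AlgHom.coe_pow, map_sum]
      refine Finset.sum_congr rfl fun l _ => ?_
      rw [map_mul, AlgHom.coe_pow, frobCoeff_iterate_tmul, one_pow]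
    have h3 : mapCoeff B σ U = ((1 : L) ⊗ₜ[k] m.det) * U := by
      rw [hU, map_mul, hWdef, AlgHom.map_det, h2, Matrix.det_mul, ← AlgHom.map_det,
        Algebra.TensorProduct.includeRight_apply, Algebra.TensorProduct.map_tmul, hσ, map_one]
      ring
    rw [← toHom_mapCoeff, h3, toHom_one_tmul_mul]

end Casorati

/-! ### Torsion points and the Weil pairing on them -/

section Torsion

/-- The `ℓ`-torsion is a vector space over the field `k[X] / ℓ`, whose dimension is determined by
the cardinality. -/
theorem exists_torsion_basis {k : Type*} [Field k] [Fintype k] {M : Type*} [AddCommGroup M]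
    [Module k[X] M] {ℓ : k[X]} (hℓ : Irreducible ℓ) {r : ℕ}
    (hcard : Nat.card {m : M // ℓ • m = 0} = Fintype.card k ^ (r * ℓ.natDegree)) :
    ∃ x : Fin r → M, (∀ i, ℓ • x i = 0) ∧
      (∀ c : Fin r → k[X], ∑ i, c i • x i = 0 → ∀ i, ℓ ∣ c i) ∧
      ∀ m, ℓ • m = 0 → ∃ c : Fin r → k[X], ∑ i, c i • x i = m := by
  have hmax : (Ideal.span {ℓ}).IsMaximal := PrincipalIdealRing.isMaximal_of_irreducible hℓ
  let _ : Field (k[X] ⧸ Ideal.span {ℓ}) := Ideal.Quotient.field _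
  let N := Submodule.torsionBy k[X] M ℓ
  have hfin : Module.Finite k (k[X] ⧸ Ideal.span {ℓ}) :=
    PowerBasis.finite (AdjoinRoot.powerBasis hℓ.ne_zero)
  have hfin' : Finite (k[X] ⧸ Ideal.span {ℓ}) := Module.finite_of_finite k
  have hcardQ : Nat.card (k[X] ⧸ Ideal.span {ℓ}) = Fintype.card k ^ ℓ.natDegree := by
    rw [Module.natCard_eq_pow_finrank (K := k), finrank_quotient_span_eq_natDegree,
      Nat.card_eq_fintype_card]
  have hcardN : Nat.card N = Fintype.card k ^ (r * ℓ.natDegree) := hcard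
  have hN : Finite N := Nat.finite_of_card_ne_zero (by
    rw [hcardN]
    exact (pow_pos Fintype.card_pos _).ne')
  have hrank : Module.finrank (k[X] ⧸ Ideal.span {ℓ}) N = r := by
    have h := Module.natCard_eq_pow_finrank (K := k[X] ⧸ Ideal.span {ℓ}) (V := N)
    rw [hcardN, hcardQ, ← pow_mul, mul_comm] at h
    exact (Nat.eq_of_mul_eq_mul_left hℓ.natDegree_pos
      (Nat.pow_right_injective (Fintype.one_lt_card (α := k)) h)).symm
  let b : Module.Basis (Fin r) (k[X] ⧸ Ideal.span {ℓ}) N := Module.finBasisOfFinrankEq _ _ hrank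
  have hsum (c : Fin r → k[X]) : ((∑ i, Ideal.Quotient.mk (Ideal.span {ℓ}) (c i) • b i : N) : M) =
      ∑ i, c i • (b i : M) := by
    rw [AddSubmonoidClass.coe_finsetSum]
    rfl
  refine ⟨fun i => b i, fun i => (Submodule.mem_torsionBy_iff _ _).1 (b i).2, fun c hc i => ?_,
    fun m hm => ?_⟩
  · rw [← hsum, ZeroMemClass.coe_eq_zero] at hc
    have := Fintype.linearIndependent_iff.1 b.linearIndependent _ hc i
    rwa [Ideal.Quotient.eq_zero_iff_dvd] at this
  · let m' : N := ⟨m, (Submodule.mem_torsionBy_iff _ _).2 hm⟩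
    choose c hc using fun i => Ideal.Quotient.mk_surjective (b.repr m' i)
    refine ⟨c, ?_⟩
    rw [← hsum]
    simp only [hc, b.sum_repr, m']

variable {k : Type*} [Field k] {ℓ : k[X]}

theorem exists_mul_eq_pow_of_ne_zero (hℓ : Irreducible ℓ) (n : ℕ)
    {b : k[X] ⧸ Ideal.span {ℓ} ^ (n + 1)} (hb : b ≠ 0) :
    ∃ b', b * b' = Ideal.Quotient.mk _ (ℓ ^ n) := by
  obtain ⟨β, rfl⟩ := Ideal.Quotient.mk_surjective b
  rw [Ne, Ideal.Quotient.eq_zero_iff_mem, Ideal.span_singleton_pow, Ideal.mem_span_singleton] at hb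
  have hβ : β ≠ 0 := fun h => hb (h ▸ dvd_zero _)
  obtain ⟨j, γ, hγ, rfl⟩ := WfDvdMonoid.max_power_factor hβ hℓ
  have hj : j ≤ n := by
    by_contra h
    exact hb (dvd_mul_of_dvd_left (pow_dvd_pow ℓ (by omega)) γ)
  obtain ⟨r, s, hrs⟩ := ((hℓ.coprime_iff_not_dvd.2 hγ).symm.pow_right (n := n + 1))
  refine ⟨Ideal.Quotient.mk _ (r * ℓ ^ (n - j)), ?_⟩
  rw [← map_mul, Ideal.Quotient.eq, Ideal.span_singleton_pow, Ideal.mem_span_singleton]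
  refine ⟨-s * ℓ ^ n, ?_⟩
  have h : ℓ ^ n = ℓ ^ j * ℓ ^ (n - j) := by rw [← pow_add, Nat.add_sub_cancel' hj]
  linear_combination (-(r * γ)) * h + ℓ ^ n * hrs

theorem finite_quotient_span_pow (hℓ : Irreducible ℓ) (n : ℕ) :
    Module.Finite k (k[X] ⧸ Ideal.span {ℓ} ^ n) := by
  rw [Ideal.span_singleton_pow]
  exact PowerBasis.finite (AdjoinRoot.powerBasis (pow_ne_zero n hℓ.ne_zero))

/-- A linear form on `k[X] / ℓ ^ (n + 1)` which does not vanish at `ℓ ^ n` vanishes on no nonzero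
ideal, as every nonzero ideal contains `ℓ ^ n`. -/
theorem exists_linearForm_quotient (hℓ : Irreducible ℓ) (n : ℕ) :
    ∃ lam : (k[X] ⧸ Ideal.span {ℓ} ^ (n + 1)) →ₗ[k] k,
      ∀ b, (∀ b', lam (b * b') = 0) → b = 0 := by
  have h : Ideal.Quotient.mk (Ideal.span {ℓ} ^ (n + 1)) (ℓ ^ n) ≠ 0 := by
    rw [Ne, Ideal.Quotient.eq_zero_iff_mem, Ideal.span_singleton_pow, Ideal.mem_span_singleton,
      pow_dvd_pow_iff hℓ.ne_zero hℓ.not_isUnit]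
    omega
  obtain ⟨lam, hlam⟩ : ∃ lam : Module.Dual k (k[X] ⧸ Ideal.span {ℓ} ^ (n + 1)),
      lam (Ideal.Quotient.mk _ (ℓ ^ n)) ≠ 0 := by
    by_contra! hall
    exact h ((Module.forall_dual_apply_eq_zero_iff k _).1 hall)
  refine ⟨lam, fun b hb => ?_⟩
  by_contra hb0
  obtain ⟨b', hb'⟩ := exists_mul_eq_pow_of_ne_zero hℓ n hb0
  exact hlam (hb' ▸ hb b')

/-- The orbit map of a vector killed by the ideal `I`, on the quotient by `I`. -/
theorem exists_orbit_map {L : Type*} [AddCommGroup L] [Module k L] (D : Module.End k L)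
    {I : Ideal k[X]} {x : L} (hx : ∀ a ∈ I, aeval D a x = 0) :
    ∃ f : (k[X] ⧸ I) →ₗ[k] L, ∀ a, f (Ideal.Quotient.mk I a) = aeval D a x := by
  let g : k[X] →ₗ[k] L := LinearMap.applyₗ x ∘ₗ (aeval D : k[X] →ₐ[k] Module.End k L).toLinearMap
  refine ⟨(I.restrictScalars k).liftQ g (fun a ha => hx a ha) ∘ₗ
    (Submodule.Quotient.restrictScalarsEquiv k I).symm.toLinearMap, fun a => rfl⟩

variable [Fintype k] {L : Type*} [Field L] [Algebra k L]

/-- The Weil pairing of a basis of the `ℓ ^ (n + 1)`-torsion of a Drinfeld module of rank `3` whose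
leading coefficient is `θ ^ (q - 1)`: a generator of the `ℓ ^ (n + 1)`-torsion of the Carlitz
module, on which automorphisms act through the determinant of their action on the basis. -/
theorem exists_carlitz_torsion (hℓ : Irreducible ℓ) (n : ℕ) {c : ℕ → L} (hc0 : c 0 ≠ 0)
    (hc3 : c 3 = c 0 ^ (Fintype.card k - 1)) {x : Fin 3 → L}
    (hx : ∀ i, aeval (twistedOp k c 3) (ℓ ^ (n + 1)) (x i) = 0)
    (hind : ∀ β : Fin 3 → k[X], ∑ i, aeval (twistedOp k c 3) (β i) (x i) = 0 →
      ∀ i, ℓ ^ (n + 1) ∣ β i) :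
    ∃ u : L, aeval (twistedOp k (carlitzCoeff (c 0)) 1) (ℓ ^ (n + 1)) u = 0 ∧
      (∀ β, aeval (twistedOp k (carlitzCoeff (c 0)) 1) β u = 0 → ℓ ^ (n + 1) ∣ β) ∧
      ∀ (σ : L →ₐ[k] L) (m : Matrix (Fin 3) (Fin 3) k[X]), (∀ j, σ (c j) = c j) →
        (∀ i, σ (x i) = ∑ j, aeval (twistedOp k c 3) (m i j) (x j)) →
        σ u = aeval (twistedOp k (carlitzCoeff (c 0)) 1) m.det u := by
  have := finite_quotient_span_pow hℓ (n + 1)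
  set D := twistedOp k c 3 with hD
  set I := Ideal.span {ℓ} ^ (n + 1) with hI
  obtain ⟨lam, hlam⟩ : ∃ lam : (k[X] ⧸ I) →ₗ[k] k, ∀ b, (∀ b', lam (b * b') = 0) → b = 0 :=
    exists_linearForm_quotient hℓ n
  have hdvd {a : k[X]} : Ideal.Quotient.mk I a = 0 ↔ ℓ ^ (n + 1) ∣ a := by
    rw [Ideal.Quotient.eq_zero_iff_mem, hI, Ideal.span_singleton_pow, Ideal.mem_span_singleton]
  choose f hf using fun i => exists_orbit_map D (I := I) (x := x i) (fun a ha => by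
    rw [hI, Ideal.span_singleton_pow, Ideal.mem_span_singleton] at ha
    obtain ⟨b, rfl⟩ := ha
    rw [mul_comm, map_mul, Module.End.mul_apply, hx, map_zero])
  have hft i b : f i (Ideal.Quotient.mk I X * b) = D (f i b) := by
    obtain ⟨β, rfl⟩ := Ideal.Quotient.mk_surjective b
    rw [← map_mul, hf, hf, map_mul, aeval_X, Module.End.mul_apply]
  obtain ⟨h, ht, hinj, hdet⟩ := exists_carlitz_of_casorati lam hlam hc0 hc3 hft (fun β hβ => by
    choose γ hγ using fun i => Ideal.Quotient.mk_surjective (β i)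
    obtain rfl : (fun i => Ideal.Quotient.mk I (γ i)) = β := funext hγ
    simp only [hf] at hβ
    exact funext fun i => hdvd.2 (hind γ hβ i))
  set Cz := twistedOp k (carlitzCoeff (c 0)) 1 with hCz
  have hu β : aeval Cz β (h 1) = h (Ideal.Quotient.mk I β) := by
    rw [← map_aeval_end_apply h (D := Algebra.lmul k _ (Ideal.Quotient.mk I X)) (fun b => by
      rw [hCz, twistedOp_carlitzCoeff_apply]
      exact ht b), aeval_algHom_apply]
    have h1 := aeval_algHom_apply (Ideal.Quotient.mkₐ k I) X β
    rw [aeval_X_left_apply] at h1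
    change h (aeval (Ideal.Quotient.mkₐ k I X) β * 1) = _
    rw [h1, mul_one]
    rfl
  refine ⟨h 1, ?_, fun β hβ => ?_, fun σ m hσ hm => ?_⟩
  · rw [hu, hdvd.2 dvd_rfl, map_zero]
  · refine hdvd.1 (hinj _ fun b' => ?_)
    obtain ⟨β', rfl⟩ := Ideal.Quotient.mk_surjective b'
    rw [← map_mul, ← hu, mul_comm, map_mul, Module.End.mul_apply, hβ, map_zero]
  · rw [hdet σ (m.map (Ideal.Quotient.mk I)) (hσ 0), mul_one, hu, RingHom.map_det]
    · rfl
    · intro i b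
      obtain ⟨β, rfl⟩ := Ideal.Quotient.mk_surjective b
      rw [hf, map_aeval_twistedOp σ hσ, hm, map_sum]
      refine Finset.sum_congr rfl fun j _ => ?_
      rw [Matrix.map_apply, ← map_mul, hf, mul_comm, map_mul, Module.End.mul_apply]

end Torsion

/-! ### Compactness of the Galois group -/

section Galois

variable {F L : Type*} [Field F] [Field L] [Algebra F L]

/-- In the Krull topology, the automorphisms with `σ u = v` form a coset of the open stabilizer
of `u`, if there are any. -/
theorem isClosed_setOf_apply_eq [Algebra.IsIntegral F L] (u v : L) :
    IsClosed {σ : L ≃ₐ[F] L | σ u = v} := by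
  rcases Set.eq_empty_or_nonempty {σ : L ≃ₐ[F] L | σ u = v} with h | ⟨τ, hτ⟩
  · rw [h]
    exact isClosed_empty
  · have h1 : IsClosed (MulAction.stabilizer (L ≃ₐ[F] L) u : Set (L ≃ₐ[F] L)) :=
      Subgroup.isClosed_of_isOpen _ (stabilizer_isOpen_of_isIntegral u)
    convert! h1.preimage (continuous_const_mul τ⁻¹) using 1
    ext σ
    rw [Set.mem_ofPred_eq, Set.mem_preimage, SetLike.mem_coe, MulAction.mem_stabilizer_iff,
      mul_smul, inv_smul_eq_iff, AlgEquiv.smul_def, AlgEquiv.smul_def, hτ]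

end Galois

/-! ### The determinant of the Galois representation -/

section Representation

/-- If `T` acts on `L` as the operator of a twisted polynomial, then `a` acts as `a` of it. -/
theorem DrinfeldModule.smul_eq_aeval {k : Type*} [Field k] [Fintype k] {F : Type*} [Field F]
    [Algebra k F] [Algebra k[X] F] (φ : DrinfeldModule k F) (L : Type*) [Field L] [Algebra k L]
    [Algebra F L] [IsScalarTower k F L] {c : ℕ → L} {r : ℕ}
    (h : ∀ z : L, TwistedPolynomial.evalHom k L (φ.toAlgHom X) z = twistedOp k c r z)
    (a : k[X]) (x : φ.Points L) : a • x = (aeval (twistedOp k c r) a (x : L) : L) := by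
  let g : k[X] →ₐ[k] Module.End k L :=
    AlgHom.mk ((TwistedPolynomial.evalHom k L).comp (φ.toAlgHom : k[X] →+* TwistedPolynomial k F))
      (fun s => by
        ext z
        have h1 : φ.toAlgHom (algebraMap k k[X] s) =
            TwistedPolynomial.C k (algebraMap k F s) * TwistedPolynomial.tau k F ^ 0 := by
          rw [AlgHom.commutes, pow_zero, mul_one]
          rfl
        change TwistedPolynomial.evalHom k L (φ.toAlgHom (algebraMap k k[X] s)) z = _
        rw [h1, TwistedPolynomial.evalHom_apply, pow_zero, pow_one,
          ← IsScalarTower.algebraMap_apply, Module.algebraMap_end_apply, Algebra.smul_def])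
  have hX : g X = twistedOp k c r := LinearMap.ext h
  have h2 := aeval_algHom_apply g X a
  rw [aeval_X_left_apply, hX] at h2
  rw [DrinfeldModule.smul_def, h2]
  rfl

namespace TateModule

/-- The determinant of the action of `e` on the Tate module reduces modulo `ℓ ^ n` to that of a
matrix of `e` on `M[ℓ ^ n]`, with rows instead of columns for the images of the basis. -/
theorem evalₐ_det_mapAut {R : Type*} [CommRing R] {ℓ : R} {M : Type*} [AddCommGroup M] [Module R M]
    {ι : Type*} [Fintype ι] [DecidableEq ι]
    (b : Module.Basis ι (AdicCompletion (Ideal.span {ℓ}) R) (TateModule ℓ M)) (e : M ≃ₗ[R] M)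
    (n : ℕ) : ∃ m : Matrix ι ι R, (∀ i, e ((b i).1 n) = ∑ j, m i j • (b j).1 n) ∧
      Ideal.Quotient.mk _ m.det =
        AdicCompletion.evalₐ (Ideal.span {ℓ}) n (LinearEquiv.det (mapAut (ℓ := ℓ) e)).1 := by
  refine ⟨Matrix.of fun i j => rep (LinearMap.toMatrix b b (mapAut e).toLinearMap j i) n,
    fun i => ?_, ?_⟩
  · have h := congrArg (fun x => x.1 n) (b.sum_repr (mapAut e (b i)))
    simp only [sum_smul_apply] at h
    refine h.symm.trans (Finset.sum_congr rfl fun j _ => ?_)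
    rw [Matrix.of_apply, LinearMap.toMatrix_apply]
    rfl
  · rw [LinearEquiv.coe_det, ← LinearMap.det_toMatrix b,
      ← Matrix.det_transpose (LinearMap.toMatrix _ _ _), RingHom.map_det, AlgHom.map_det]
    congr 1
    ext i j : 2
    simp [mk_rep]

end TateModule

end Representation

theorem proposition6p3 (k : Type*) [Field k] [Fintype k]
    (hodd : Odd (Fintype.card k)) (hq : 7 ≤ Fintype.card k)
    (g₁ g₂ : k[X])
    (hg₁ : Ideal.span {g₁, X ^ Fintype.card k - X} = Ideal.span {(X : k[X])} ∨
      Ideal.span {g₁, X ^ Fintype.card k - X} = Ideal.span {(X : k[X]) ^ Fintype.card k - X})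
    (hg₂ : IsCoprime g₂ (X ^ Fintype.card k - X))
    (φ : DrinfeldModule k (RatFunc k))
    (hφ : φ.toAlgHom X =
      TwistedPolynomial.C k (algebraMap k[X] (RatFunc k) X) +
      TwistedPolynomial.C k (algebraMap k[X] (RatFunc k) (g₁ ^ (Fintype.card k - 1))) *
        TwistedPolynomial.tau k (RatFunc k) +
      TwistedPolynomial.C k (algebraMap k[X] (RatFunc k) (g₂ ^ (Fintype.card k - 1))) *
        TwistedPolynomial.tau k (RatFunc k) ^ 2 +
      TwistedPolynomial.C k (algebraMap k[X] (RatFunc k) (X ^ (Fintype.card k - 1))) *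
        TwistedPolynomial.tau k (RatFunc k) ^ 3)
    (ℓ : k[X]) (hℓ : Irreducible ℓ) :
    Nonempty (Module.Basis (Fin 3) (AdicCompletion (Ideal.span {ℓ}) k[X]) (φ.Tate ℓ)) ∧
    Function.Surjective fun σ : SeparableClosure (RatFunc k) ≃ₐ[RatFunc k]
      SeparableClosure (RatFunc k) => LinearEquiv.det (φ.adicRep ℓ σ) := by

  set L := SeparableClosure (RatFunc k) with hL
  have : IsScalarTower k k[X] L := IsScalarTower.of_algebraMap_eq fun s => by
    rw [IsScalarTower.algebraMap_apply k (RatFunc k) L,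
      IsScalarTower.algebraMap_apply k k[X] (RatFunc k),
      ← IsScalarTower.algebraMap_apply k[X] (RatFunc k) L]
  let d : ℕ → k[X] := fun
    | 0 => X
    | 1 => g₁ ^ (Fintype.card k - 1)
    | 2 => g₂ ^ (Fintype.card k - 1)
    | _ => X ^ (Fintype.card k - 1)
  let c : ℕ → L := fun j => algebraMap k[X] L (d j)
  have hinjL : Function.Injective (algebraMap k[X] L) := by
    rw [IsScalarTower.algebraMap_eq k[X] (RatFunc k) L]
    exact (algebraMap (RatFunc k) L).injective.comp (IsFractionRing.injective k[X] (RatFunc k))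
  have hc0 : c 0 ≠ 0 := (map_ne_zero_iff _ hinjL).2 X_ne_zero
  have hc3 : c 3 = c 0 ^ (Fintype.card k - 1) := map_pow _ _ _
  have hc3' : c 3 ≠ 0 := hc3 ▸ pow_ne_zero _ hc0
  -- `θ` is transcendental over `k`, so the polynomial of `ℓ` is separable.
  have hsep : aeval (c 0) ℓ ≠ 0 := by
    have h : aeval (c 0) ℓ = algebraMap k[X] L ℓ := by
      change aeval (algebraMap k[X] L X) ℓ = _
      rw [aeval_algebraMap_apply, aeval_X_left_apply]
    rw [h]
    exact (map_ne_zero_iff _ hinjL).2 hℓ.ne_zero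
  have hσc (σ : L ≃ₐ[RatFunc k] L) (j : ℕ) : σ (c j) = c j := by
    change σ (algebraMap k[X] L (d j)) = _
    rw [IsScalarTower.algebraMap_apply k[X] (RatFunc k) L, σ.commutes]
    exact (IsScalarTower.algebraMap_apply k[X] (RatFunc k) L _).symm
  have hev (z : L) : TwistedPolynomial.evalHom k L (φ.toAlgHom X) z = twistedOp k c 3 z := by
    have h0 p := TwistedPolynomial.evalHom_apply k L (algebraMap k[X] (RatFunc k) p) 0 z
    have h1 p := TwistedPolynomial.evalHom_apply k L (algebraMap k[X] (RatFunc k) p) 1 z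
    simp only [pow_zero, mul_one, pow_one] at h0 h1
    rw [hφ, map_add, map_add, map_add, LinearMap.add_apply, LinearMap.add_apply,
      LinearMap.add_apply, h0, h1, TwistedPolynomial.evalHom_apply,
      TwistedPolynomial.evalHom_apply, twistedOp_apply]
    simp only [← IsScalarTower.algebraMap_apply k[X] (RatFunc k) L, Finset.sum_range_succ,
      Finset.sum_range_zero, zero_add, pow_zero, pow_one]
    rfl
  have hsmul (a : k[X]) (x : φ.Points L) : a • x = (aeval (twistedOp k c 3) a (x : L) : L) :=
    φ.smul_eq_aeval L hev a x
  obtain ⟨x, hx0, hxind, hxgen⟩ := exists_torsion_basis (M := φ.Points L) hℓ (r := 3) (by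
    rw [← card_ker_aeval_twistedOp (L := L) (c := c) (r := 3) (by norm_num) hc3' hsep]
    exact Nat.card_congr (Equiv.subtypeEquivRight fun x => by rw [hsmul]; rfl))
  have hdiv (m : φ.Points L) : ∃ m' : φ.Points L, ℓ • m' = m := by
    obtain ⟨y, hy⟩ := aeval_twistedOp_surjective (L := L) (c := c) (r := 3) (by norm_num) hc3'
      hsep m
    exact ⟨y, (hsmul ℓ y).trans hy⟩
  choose e he using fun i => TateModule.exists_apply_one_eq hdiv (hx0 i)
  have hind : ∀ c : Fin 3 → k[X], ∑ i, c i • (e i).1 1 = 0 → ∀ i, ℓ ∣ c i := by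
    simpa only [he] using hxind
  obtain ⟨b, hb⟩ := TateModule.nonempty_basis hind (by simpa only [he] using hxgen)
  refine ⟨⟨b⟩, fun α => ?_⟩
  have hlevel n := exists_carlitz_torsion hℓ n (L := L) hc0 hc3 (x := fun i => (e i).1 (n + 1))
    (fun i => by
      have := (e i).2.1 (n + 1)
      rwa [Submodule.mem_torsionBy_iff, hsmul] at this)
    (fun β hβ => TateModule.pow_dvd_of_sum_eq_zero hind (n + 1) β (by
      simp only [hsmul]
      exact hβ))
  choose u hu0 hudvd hudet using hlevel
  set Cz := twistedOp k (carlitzCoeff (c 0)) 1 with hCz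
  -- At level `n + 1` the determinant of `σ` is the scalar by which `σ` multiplies `u n`.
  have hdet (σ : L ≃ₐ[RatFunc k] L) (n : ℕ) (β : k[X]) : σ (u n) = aeval Cz β (u n) ↔
      AdicCompletion.evalₐ (Ideal.span {ℓ}) (n + 1) (LinearEquiv.det (φ.adicRep ℓ σ)).1 =
        Ideal.Quotient.mk _ β := by
    obtain ⟨m, hm, hmdet⟩ := TateModule.evalₐ_det_mapAut b (φ.galoisAction L σ) (n + 1)
    have h := hudet n (σ.toAlgHom.restrictScalars k) m (hσc σ) (fun i => by
      have := hm i
      simp only [hb, hsmul] at this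
      exact this)
    change σ (u n) = _ at h
    change _ ↔ AdicCompletion.evalₐ (Ideal.span {ℓ}) (n + 1)
      (LinearEquiv.det (TateModule.mapAut (ℓ := ℓ) (φ.galoisAction L σ))).1 = _
    rw [← hmdet, h, Ideal.Quotient.eq, Ideal.span_singleton_pow, Ideal.mem_span_singleton,
      ← sub_eq_zero, ← LinearMap.sub_apply, ← map_sub]
    refine ⟨hudvd n _, ?_⟩
    rintro ⟨γ, hγ⟩
    rw [hγ, mul_comm, map_mul, Module.End.mul_apply, hu0, map_zero]
  -- `S n` consists of the automorphisms with determinant `α` modulo `ℓ ^ (n + 1)`.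
  let S : ℕ → Set (L ≃ₐ[RatFunc k] L) := fun n =>
    {σ | σ (u n) = aeval Cz (TateModule.rep α.1 (n + 1)) (u n)}
  have hS (n : ℕ) (σ : L ≃ₐ[RatFunc k] L) : σ ∈ S n ↔
      AdicCompletion.evalₐ (Ideal.span {ℓ}) (n + 1) (LinearEquiv.det (φ.adicRep ℓ σ)).1 =
        AdicCompletion.evalₐ (Ideal.span {ℓ}) (n + 1) α.1 := by
    rw [← TateModule.mk_rep α.1]
    exact hdet σ n _
  have hfactor {x y : AdicCompletion (Ideal.span {ℓ}) k[X]} {n : ℕ}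
      (h : AdicCompletion.evalₐ (Ideal.span {ℓ}) (n + 1) x = AdicCompletion.evalₐ _ (n + 1) y) :
      AdicCompletion.evalₐ (Ideal.span {ℓ}) n x = AdicCompletion.evalₐ _ n y := by
    rw [← TateModule.mk_rep, ← TateModule.mk_rep, Ideal.Quotient.eq] at h
    rw [← TateModule.mk_rep_succ, ← TateModule.mk_rep_succ, Ideal.Quotient.eq]
    exact Ideal.pow_le_pow_right (Nat.le_succ n) h
  obtain ⟨σ, hσ⟩ := IsCompact.nonempty_iInter_of_sequence_nonempty_isCompact_isClosed S
    (fun n σ hσ => by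
      rw [hS] at hσ ⊢
      exact hfactor hσ)
    (fun n => by
      refine exists_algEquiv_carlitz hℓ (hu0 n) (fun h => ?_) (fun h => ?_)
      · have := hudvd n _ h
        rw [pow_dvd_pow_iff hℓ.ne_zero hℓ.not_isUnit] at this
        omega
      · have h1 := α.isUnit.map (AdicCompletion.evalₐ (Ideal.span {ℓ}) (n + 1))
        rw [← TateModule.mk_rep] at h1
        obtain ⟨y, hy⟩ := h1.exists_right_inv
        obtain ⟨γ, rfl⟩ := Ideal.Quotient.mk_surjective y
        rw [← map_mul, ← map_one (Ideal.Quotient.mk _), Ideal.Quotient.eq, Ideal.span_singleton_pow,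
          Ideal.mem_span_singleton] at hy
        have h2 := (dvd_pow_self ℓ n.succ_ne_zero).trans hy
        exact hℓ.not_isUnit (isUnit_of_dvd_one ((dvd_sub_right (h.mul_right γ)).1 h2)))
    (isClosed_setOf_apply_eq _ _).isCompact (fun n => isClosed_setOf_apply_eq _ _)
  refine ⟨σ, Units.ext (AdicCompletion.ext_evalₐ fun n => ?_)⟩
  exact hfactor ((hS n σ).1 (Set.mem_iInter.1 hσ n))
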